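/- Let $\mathbb{F}_q$ be a finite field, $A=\mathbb{F}_q[T]$, $F=\mathbb{F}_q(T)$. Let $k$ be a finite field with an $A$-algebra structure $\gamma:A\to k$ (so $k$ is a finite extension of $A/\mathfrak p$, $\mathfrak p=\ker\gamma$), and let $k\{\tau\}$ be the ring of polynomials in $\tau$ with the rule $\tau c=c^q\tau$. Let $\phi:A\to k\{\tau\}$, $a\mapsto\phi_a$, be a Drinfeld module of rank $r\ge 1$ over $k$, i.e. an $\mathbb{F}_q$-algebra homomorphism with $\phi_T=\gamma(T)+\sum_{i=1}^r g_i\tau^i$, $g_r\neq 0$. Let $\mathcal{E}=\mathrm{End}_k(\phi)$ be the centralizer of $\phi(A)$ in $k\{\tau\}$, an $A$-algebra via $\phi$; let $\pi=\tau^{[k:\mathbb{F}_q]}\in\mathcal{E}$, $D=\mathcal{E}\otimes_A F$, and let $K=F(\pi)\subset D$ be the subfield generated by $\pi$. Assume $[K:F]=r$; then $\mathcal{E}$ is an $A$-order in $K$. Let $B$ be the integral closure of $A$ in $K$, so that $A[\pi]\subseteq\mathcal{E}\subseteq B$. For $A$-orders $\mathcal{O}\subseteq\mathcal{O}'$ in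 $K$ let $\chi(\mathcal{O}'/\mathcal{O})$ be the ideal of $A$ generated by the product of the invariant factors of the $A$-module $\mathcal{O}'/\mathcal{O}$. Let $\mathfrak l$ be a nonzero prime ideal of $A$, let $A_{\mathfrak l}$ be the completion of $A$ at $\mathfrak l$, and put $\mathcal{E}_{\mathfrak l}=\mathcal{E}\otimes_A A_{\mathfrak l}$. A finite flat local $A_{\mathfrak l}$-algebra $R$ with maximal ideal $\mathfrak M$ is called Gorenstein if, with $\bar R=R/\mathfrak l R$, the space $\{a\in\bar R\mid ma=0\text{ for all }m\in\mathfrak M\}$ has dimension $1$ over $R/\mathfrak M$; a commutative finite flat $A_{\mathfrak l}$-algebra is called Gorenstein if its localization at every maximal ideal is a Gorenstein local ring. Suppose that one of the following conditions holds: (1) $\mathcal{E}_{\mathfrak l}=A_{\mathfrak l}[\pi]$; (2) $r=2$; (3) $\mathcal{E}_{\mathfrak l}=B\otimes_A A_{\mathfrak l}$ (inside $D\otimes_A A_{\mathfrak l}$). Then $\mathcal{E}_{\mathfrak l}$ is Gorenstein (in particular commutative, finite and flat over $A_{\mathfrak l}$). In particular, if $\mathfrak l$ does not divide $\chi(\mathcal{E}/A[\pi])$,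 or $\mathfrak l$ does not divide $\chi(B/\mathcal{E})$ (at least one of the two), then $\mathcal{E}_{\mathfrak l}$ is Gorenstein. -/

import Mathlib

open scoped TensorProduct Polynomial

noncomputable section

/-! ### Twisted polynomials -/

/-- The `q`-power Frobenius `x ↦ x ^ q` of `k`, where `q = #Fq`. -/
def qFrob (Fq k : Type*) [Field Fq] [Fintype Fq] [Field k] [Algebra Fq k] : k →+* k :=
  (FiniteField.frobeniusAlgHom Fq k).toRingHom

/-- The action of the monoid `{1, τ, τ ^ 2, …}` on `k` in which `τ` acts as `x ↦ x ^ q`. -/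
@[reducible] def qFrobAction (Fq k : Type*) [Field Fq] [Fintype Fq] [Field k] [Algebra Fq k] :
    MulSemiringAction (Multiplicative ℕ) k :=
  MulSemiringAction.compHom k (powersHom (k →+* k) (qFrob Fq k))

/-- The ring `k{τ}` of polynomials in `τ` with the commutation rule `τ c = c ^ q τ`. -/
def TwistedPoly (Fq k : Type*) [Field Fq] [Fintype Fq] [Field k] [Algebra Fq k] : Type _ :=
  SkewPolynomial k

namespace TwistedPoly

variable (Fq k : Type*) [Field Fq] [Fintype Fq] [Field k] [Algebra Fq k]

instance : Ring (TwistedPoly Fq k) :=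
  letI := qFrobAction Fq k
  inferInstanceAs (Ring (SkewPolynomial k))

/-- The inclusion of the constants `k → k{τ}`. -/
def const : k →+* TwistedPoly Fq k :=
  letI := qFrobAction Fq k
  (SkewPolynomial.CRingHom : k →+* SkewPolynomial k)

/-- The indeterminate `τ`. -/
def tau : TwistedPoly Fq k := (SkewPolynomial.X : SkewPolynomial k)

theorem tau_mul_const (c : k) :
    tau Fq k * const Fq k c = const Fq k (c ^ Fintype.card Fq) * tau Fq k := by
  let := qFrobAction Fq k
  have h := SkewPolynomial.X_mul_monomial (R := k) 0 c
  have h' := SkewPolynomial.monomial_mul_X (R := k) 0 (c ^ Fintype.card Fq)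
  exact h.trans h'.symm

theorem tau_pow_mul_const (n : ℕ) (c : k) :
    tau Fq k ^ n * const Fq k c = const Fq k (c ^ Fintype.card Fq ^ n) * tau Fq k ^ n := by
  induction n with
  | zero => simp
  | succ n ih =>
    rw [pow_succ', mul_assoc, ih, ← mul_assoc, tau_mul_const, mul_assoc, ← pow_mul, ← pow_succ]

theorem induction {P : TwistedPoly Fq k → Prop} (h0 : P 0) (hadd : ∀ x y, P x → P y → P (x + y))
    (hmon : ∀ (n : ℕ) (c : k), P (const Fq k c * tau Fq k ^ n)) (u : TwistedPoly Fq k) : P u := by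
  let := qFrobAction Fq k
  refine SkewPolynomial.induction (motive := P) u h0 fun n a f _ _ hf => hadd _ _ ?_ hf
  have h := SkewPolynomial.C_mul_X_pow_eq_monomial (R := k) (n := n) (a := a)
  rw [← h]
  exact hmon n a

/-- `τ ^ n` is central in `k{τ}` when `n = [k : Fq]`. -/
theorem tau_pow_finrank_comm [Finite k] (u : TwistedPoly Fq k) :
    tau Fq k ^ Module.finrank Fq k * u = u * tau Fq k ^ Module.finrank Fq k := by
  have := Fintype.ofFinite k
  induction u using TwistedPoly.induction with
  | h0 => simp
  | hadd x y hx hy => rw [mul_add, add_mul, hx, hy]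
  | hmon m c =>
    have hc : c ^ Fintype.card Fq ^ Module.finrank Fq k = c := by
      rw [← Module.card_eq_pow_finrank (K := Fq) (V := k), FiniteField.pow_card]
    rw [← mul_assoc, tau_pow_mul_const, hc, mul_assoc, mul_assoc, ← pow_add, ← pow_add, add_comm]

end TwistedPoly

/-! ### Drinfeld modules and their endomorphism rings -/

/-- A Drinfeld `Fq[T]`-module of rank `r` over the `Fq[T]`-field `k`, whose structure map
`γ : Fq[T] → k` is `algebraMap Fq[X] k`. -/
structure DrinfeldModule (Fq k : Type*) [Field Fq] [Fintype Fq] [Field k] [Algebra Fq k]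
    [Algebra Fq[X] k] (r : ℕ) where
  /-- The ring homomorphism `a ↦ φ_a`. -/
  toRingHom : Fq[X] →+* TwistedPoly Fq k
  /-- `φ` is `Fq`-linear. -/
  map_C : ∀ c : Fq, toRingHom (Polynomial.C c) = TwistedPoly.const Fq k (algebraMap Fq k c)
  rank_pos : 1 ≤ r
  /-- `φ_T = γ(T) + g₁ τ + ⋯ + g_r τ ^ r` with `g_r ≠ 0`. -/
  map_X : ∃ g : ℕ → k, g r ≠ 0 ∧
    toRingHom Polynomial.X = TwistedPoly.const Fq k (algebraMap Fq[X] k Polynomial.X) +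
      ∑ i ∈ Finset.Icc 1 r, TwistedPoly.const Fq k (g i) * TwistedPoly.tau Fq k ^ i

namespace DrinfeldModule

variable {Fq k : Type*} [Field Fq] [Fintype Fq] [Field k] [Algebra Fq k] [Algebra Fq[X] k] {r : ℕ}

/-- The endomorphism ring `ℰ = End_k(φ)`: the centralizer of `φ(A)` in `k{τ}`. -/
abbrev EndRing (φ : DrinfeldModule Fq k r) : Type _ :=
  Subring.centralizer (Set.range φ.toRingHom)

/-- `ℰ` is an `A`-algebra through `a ↦ φ_a`. -/
instance (φ : DrinfeldModule Fq k r) : Algebra Fq[X] φ.EndRing :=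
  RingHom.toAlgebra'
    (φ.toRingHom.codRestrict (Subring.centralizer (Set.range φ.toRingHom)) (by
      rintro a _ ⟨b, rfl⟩
      rw [← map_mul, ← map_mul, mul_comm]))
    (fun a u => Subtype.ext (u.2 _ ⟨a, rfl⟩))

/-- The Frobenius endomorphism `π = τ ^ [k : Fq]`. -/
def frob [Finite k] (φ : DrinfeldModule Fq k r) : φ.EndRing :=
  ⟨TwistedPoly.tau Fq k ^ Module.finrank Fq k, fun _ _ =>
    (TwistedPoly.tau_pow_finrank_comm Fq k _).symm⟩

/-- The endomorphism algebra `D = ℰ ⊗_A F`, where `F = Fq(T)`. -/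
abbrev EndAlg (φ : DrinfeldModule Fq k r) : Type _ := RatFunc Fq ⊗[Fq[X]] φ.EndRing

/-- The image of `ℰ` in `D`. -/
def endLattice (φ : DrinfeldModule Fq k r) : Submodule Fq[X] φ.EndAlg :=
  LinearMap.range (TensorProduct.mk Fq[X] (RatFunc Fq) φ.EndRing 1)

/-- `K = F(π)`, the subfield of `D` generated by `π` over `F`; as `π` is algebraic over `F`, this is
the `F`-subalgebra `F[π]`. -/
def frobField [Finite k] (φ : DrinfeldModule Fq k r) : Subalgebra (RatFunc Fq) φ.EndAlg :=
  Algebra.adjoin (RatFunc Fq) {1 ⊗ₜ φ.frob}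

theorem frobField_mul_comm [Finite k] (φ : DrinfeldModule Fq k r) (x y : φ.frobField) :
    x * y = y * x :=
  (Algebra.isMulCommutative_adjoin (RatFunc Fq) (s := {1 ⊗ₜ[Fq[X]] φ.frob}) (by
    rintro a rfl b rfl
    rfl)).is_comm.comm x y

instance [Finite k] (φ : DrinfeldModule Fq k r) : CommRing φ.frobField :=
  { (inferInstance : Ring φ.frobField) with mul_comm := φ.frobField_mul_comm }

/-- The integral closure `B` of `A` in `K`, as an `A`-submodule of `D`. -/
def maxLattice [Finite k] (φ : DrinfeldModule Fq k r) : Submodule Fq[X] φ.EndAlg :=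
  (integralClosure Fq[X] φ.frobField).toSubmodule.map
    (φ.frobField.val.restrictScalars Fq[X]).toLinearMap

/-- `A[π]`, as an `A`-subalgebra of `ℰ`. -/
def frobOrder [Finite k] (φ : DrinfeldModule Fq k r) : Subalgebra Fq[X] φ.EndRing :=
  Algebra.adjoin Fq[X] {φ.frob}

/-- `ℰ_𝔩 = ℰ ⊗_A A_𝔩`, where `A_𝔩` is the `𝔩`-adic completion of `A`. -/
abbrev EndCompletion (φ : DrinfeldModule Fq k r) (l : Ideal Fq[X]) : Type _ :=
  AdicCompletion l Fq[X] ⊗[Fq[X]] φ.EndRing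

end DrinfeldModule

/-! ### The index of one order in another -/

/-- The ideal `χ(M)` of `A` generated by the product `b₁ ⋯ bₙ` of the invariant factors of the
finitely generated torsion `A`-module `M`, that is, of nonzero elements `b₁ ∣ b₂ ∣ ⋯ ∣ bₙ` with
`M ≃ A/b₁ × ⋯ × A/bₙ`. (Any two such sequences have associated products.) -/
def moduleIndex (A M : Type*) [CommRing A] [AddCommGroup M] [Module A M] : Ideal A :=
  Ideal.span {c | ∃ (n : ℕ) (b : Fin n → A), (∀ i, b i ≠ 0) ∧ (∀ i j, i ≤ j → b i ∣ b j) ∧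
    Nonempty (M ≃ₗ[A] (∀ i, A ⧸ Ideal.span {b i})) ∧ c = ∏ i, b i}

/-! ### Gorenstein algebras -/

/-- The Gorenstein condition on a local ring `R` that is a finite flat algebra over a complete
discrete valuation ring `O` with maximal ideal `𝔩`: for `R̄ = R/𝔩R`, the elements of `R̄`
annihilated by the maximal ideal `𝔐` of `R` form a vector space of dimension `1` over `R/𝔐`. -/
def IsGorensteinLocal {O : Type*} [CommRing O] (l : Ideal O) (R : Type*) [CommRing R] [Algebra O R]
    [IsLocalRing R] : Prop :=
  Module.finrank (R ⧸ IsLocalRing.maximalIdeal R)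
    (Submodule.torsionBySet R (R ⧸ l.map (algebraMap O R)) (IsLocalRing.maximalIdeal R)) = 1

/-- The `O`-algebra `R`, where `O` is a complete discrete valuation ring with maximal ideal `𝔩`, is
commutative, finite and flat over `O`, and its localization at every maximal ideal is Gorenstein. -/
structure IsGorensteinAlgebra {O : Type*} [CommRing O] (l : Ideal O) (R : Type*) [Ring R]
    [Algebra O R] : Prop where
  comm : ∀ x y : R, x * y = y * x
  finite : Module.Finite O R
  flat : Module.Flat O R
  local_gorenstein :
    letI : CommRing R := { ‹Ring R› with mul_comm := comm }
    ∀ (M : Ideal R) [M.IsMaximal], IsGorensteinLocal l (Localization.AtPrime M)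

end

noncomputable section

/-! ### Socles of principal ideal rings -/

/-! The criterion behind every case: if `R/𝔩R` is an Artinian principal ideal ring, then `R` is
Gorenstein. In an Artinian local principal ideal ring the annihilator of the maximal ideal is
generated by one element, and it is nonzero because the maximal ideal is nilpotent; so it is a line
over the residue field.

The reduction is principal in each case. If `ℰ_𝔩 = A_𝔩[π]`, it is a quotient of `(A_𝔩/𝔩A_𝔩)[X]`. If
`r = 2`, then `ℰ/𝔩ℰ` has dimension at most 2 over `A/𝔩`, hence is generated by one element. If `ℰ_𝔩`
is maximal, the localization of `ℰ` at `A ∖ 𝔩` is a semilocal Dedekind domain, hence principal, and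
`ℰ/𝔩ℰ` is a quotient of it. When `𝔩` does not divide an index, some `c ∉ 𝔩` kills the quotient of
orders, and this leads back to the first or the third argument.

What remains is that `ℰ` is commutative, finite and torsion-free over `A`, of rank at most `r`.
Regard `k{τ}` as a `k[X]`-module, with `k` acting on the left and `X` by right multiplication by
`φ_T`. It is torsion-free and spanned by `1, τ, …, τ^(r-1)`, and `ℰ` acts on it `k[X]`-linearly by
right multiplication. A trace argument (`linearIndependent_endMul`) shows that `A`-independent
elements of `ℰ` act `k[X]`-independently. Since `[K : F] = r`, the powers `1, π, …, π^(r-1)` act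
independently on a module of rank at most `r`, so over the fraction field `π` has a cyclic vector.
The commutant of such an operator is commutative of dimension at most `r`, and `ℰ` lies in it
because `π` is central. In particular `D = K`. -/

theorem finrank_torsionBySet_maximalIdeal_eq_one {L : Type*} [CommRing L] [IsLocalRing L]
    (I : Ideal L) [Nontrivial (L ⧸ I)] [IsPrincipalIdealRing (L ⧸ I)] [IsArtinianRing (L ⧸ I)] :
    Module.finrank (L ⧸ IsLocalRing.maximalIdeal L)
      (Submodule.torsionBySet L (L ⧸ I) (IsLocalRing.maximalIdeal L)) = 1 := by
  have : IsLocalRing (L ⧸ I) :=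
    IsLocalRing.of_surjective' (Ideal.Quotient.mk I) Ideal.Quotient.mk_surjective
  set m := IsLocalRing.maximalIdeal L with hm
  set J : Ideal (L ⧸ I) := m.map (Ideal.Quotient.mk I) with hJ
  have hJne : J ≠ ⊤ := by
    intro h
    have hI : I ≤ m := IsLocalRing.le_maximalIdeal (Ideal.Quotient.nontrivial_iff.1 inferInstance)
    have := Ideal.comap_map_of_surjective' (Ideal.Quotient.mk I) Ideal.Quotient.mk_surjective m
    rw [← hJ, h, Ideal.comap_top, Ideal.mk_ker, sup_eq_left.2 hI] at this
    exact (IsLocalRing.maximalIdeal.isMaximal L).ne_top this.symm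
  have hJnil : IsNilpotent J := by
    obtain ⟨n, hn⟩ := IsArtinianRing.isNilpotent_jacobson_bot (R := L ⧸ I)
    refine ⟨n, le_bot_iff.1 (le_trans (Ideal.pow_right_mono ?_ n) hn.le)⟩
    rw [IsLocalRing.jacobson_eq_maximalIdeal ⊥ bot_ne_top]
    exact IsLocalRing.le_maximalIdeal hJne
  have hmem (w : L ⧸ I) : w ∈ Submodule.torsionBySet L (L ⧸ I) m ↔ w ∈ J.annihilator := by
    rw [Submodule.mem_torsionBySet_iff, Submodule.mem_annihilator]
    constructor
    · intro h y hy
      obtain ⟨x, hx, rfl⟩ := (Ideal.mem_map_iff_of_surjective _ Ideal.Quotient.mk_surjective).1 hy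
      rw [smul_eq_mul, mul_comm]
      exact (Algebra.smul_def x w).symm.trans (h ⟨x, hx⟩)
    · rintro h ⟨x, hx⟩
      have := h _ (Ideal.mem_map_of_mem (Ideal.Quotient.mk I) hx)
      rw [smul_eq_mul, mul_comm] at this
      exact (Algebra.smul_def x w).trans this
  obtain ⟨w, hw⟩ := (IsPrincipalIdealRing.principal J.annihilator).principal
  have hwmem : w ∈ J.annihilator := hw ▸ Submodule.mem_span_singleton_self w
  have hw0 : w ≠ 0 := by
    rintro rfl
    rw [Submodule.span_singleton_eq_bot.2 rfl] at hw
    classical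
    -- For the least `n` with `J ^ n = 0`, the power `J ^ (n - 1)` annihilates `J`; if the
    -- annihilator vanished, `n` would not be least.
    have hex : ∃ n, J ^ n = 0 := hJnil
    have hn := Nat.find_spec hex
    rcases h : Nat.find hex with _ | n
    · rw [h, pow_zero] at hn
      exact one_ne_zero hn
    · rw [h, pow_succ] at hn
      refine Nat.find_min hex (m := n) (by lia) (le_bot_iff.1 ?_)
      rw [← hw]
      intro x hx
      rw [Submodule.mem_annihilator]
      intro y hy
      have := Ideal.mul_mem_mul hx hy
      rw [hn] at this
      exact this
  let := Ideal.Quotient.field m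
  refine (finrank_eq_one_iff_of_nonzero'
    (⟨w, (hmem w).2 hwmem⟩ : Submodule.torsionBySet L (L ⧸ I) m)
    (fun h => hw0 (congrArg Subtype.val h))).2 ?_
  rintro ⟨x, hx⟩
  rw [hmem, hw, Submodule.mem_span_singleton] at hx
  obtain ⟨a, rfl⟩ := hx
  obtain ⟨a, rfl⟩ := Ideal.Quotient.mk_surjective a
  exact ⟨Ideal.Quotient.mk m a, Subtype.ext (Algebra.smul_def a w)⟩

theorem finrank_socle_localization_eq_one {R : Type*} [CommRing R] (J : Ideal R)
    [IsPrincipalIdealRing (R ⧸ J)] [IsArtinianRing (R ⧸ J)] (M : Ideal R) [M.IsMaximal]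
    (hJM : J ≤ M) (I : Ideal (Localization.AtPrime M))
    (hI : I = J.map (algebraMap R (Localization.AtPrime M))) :
    Module.finrank (Localization.AtPrime M ⧸ IsLocalRing.maximalIdeal (Localization.AtPrime M))
      (Submodule.torsionBySet (Localization.AtPrime M) (Localization.AtPrime M ⧸ I)
        (IsLocalRing.maximalIdeal (Localization.AtPrime M))) = 1 := by
  set L := Localization.AtPrime M
  have hIne : I ≠ ⊤ := by
    have : I ≤ IsLocalRing.maximalIdeal L := by
      rw [hI, ← Localization.AtPrime.map_eq_maximalIdeal]
      exact Ideal.map_mono hJM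
    exact fun h => (IsLocalRing.maximalIdeal.isMaximal L).ne_top (top_le_iff.1 (h ▸ this))
  have : Nontrivial (L ⧸ I) := Ideal.Quotient.nontrivial_iff.2 hIne
  let f : R ⧸ J →+* L ⧸ I := Ideal.quotientMap I (algebraMap R L) (by
    rw [hI]; exact Ideal.le_comap_map)
  have hf : Function.Surjective f := by
    intro y
    obtain ⟨y, rfl⟩ := Ideal.Quotient.mk_surjective y
    obtain ⟨a, s, rfl⟩ := IsLocalization.exists_mk'_eq M.primeCompl y
    have hu : IsUnit (f (Ideal.Quotient.mk J s)) := by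
      have : f (Ideal.Quotient.mk J s) = Ideal.Quotient.mk I (algebraMap R L s) := by
        simp [f]
      rw [this]
      exact (IsLocalization.map_units L s).map _
    -- The powers of `s` stabilize in `R/J`, giving `s ^ (n + 1) * t = s ^ n`. As `s` becomes a unit
    -- in `L/I`, `t` maps to its inverse, so the fraction `a/s` is the image of `a * t`.
    obtain ⟨n, t, ht⟩ := IsArtinian.exists_pow_succ_smul_dvd (Ideal.Quotient.mk J s) (1 : R ⧸ J)
    refine ⟨Ideal.Quotient.mk J a * t, ?_⟩
    have h1 : f (Ideal.Quotient.mk J s) * f t = 1 := by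
      have := congrArg f ht
      rw [smul_eq_mul, smul_eq_mul, pow_succ, mul_assoc, map_mul, map_mul, map_mul, map_pow,
        map_one] at this
      exact (hu.pow n).mul_left_cancel this
    have h2 : f (Ideal.Quotient.mk J s) * Ideal.Quotient.mk I (IsLocalization.mk' L a s) =
        f (Ideal.Quotient.mk J a) := by
      simp only [f, Ideal.quotientMap_mk]
      rw [← map_mul, IsLocalization.mk'_spec']
    rw [map_mul, ← h2, mul_comm, ← mul_assoc, mul_comm (f t), h1, one_mul]
  have := IsPrincipalIdealRing.of_surjective f hf
  have := hf.isArtinianRing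
  exact finrank_torsionBySet_maximalIdeal_eq_one I

/-! ### The Gorenstein property over the completion -/

theorem isArtinianRing_quotient_map {A E : Type*} [CommRing A] [CommRing E] [Algebra A E]
    (l : Ideal A) [l.IsMaximal] [Module.Finite A E] :
    IsArtinianRing (E ⧸ l.map (algebraMap A E)) := by
  let := Ideal.Quotient.field l
  have : Module.Finite (A ⧸ l) (E ⧸ l.map (algebraMap A E)) :=
    Module.Finite.of_restrictScalars_finite A _ _
  exact IsArtinianRing.of_finite (A ⧸ l) _

theorem isPrincipalIdealRing_quotient_map_of_adjoin_eq_top {O R : Type*} [CommRing O] [CommRing R]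
    [Algebra O R] (m : Ideal O) [m.IsMaximal] (x : R) (h : Algebra.adjoin O {x} = ⊤) :
    IsPrincipalIdealRing (R ⧸ m.map (algebraMap O R)) := by
  let := Ideal.Quotient.field m
  let J := m.map (algebraMap O R)
  let g : O ⧸ m →+* R ⧸ J := Ideal.quotientMap J (algebraMap _ _) Ideal.le_comap_map
  refine IsPrincipalIdealRing.of_surjective (Polynomial.eval₂RingHom g (Ideal.Quotient.mk J x))
    fun y => ?_
  obtain ⟨y, rfl⟩ := Ideal.Quotient.mk_surjective y
  change _ ∈ (Polynomial.eval₂RingHom g (Ideal.Quotient.mk J x)).rangeS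
  have hy : y ∈ Algebra.adjoin O {x} := h ▸ Algebra.mem_top
  induction hy using Algebra.adjoin_induction with
  | mem y hy =>
    rw [Set.mem_singleton_iff.1 hy]
    exact ⟨Polynomial.X, by simp [J]⟩
  | algebraMap r => exact ⟨Polynomial.C (Ideal.Quotient.mk m r), by simp [g, J]⟩
  | add x y _ _ hx hy => rw [map_add]; exact add_mem hx hy
  | mul x y _ _ hx hy => rw [map_mul]; exact mul_mem hx hy

section Completion

variable {A : Type*} [CommRing A] [IsNoetherianRing A] (l : Ideal A)

theorem AdicCompletion.exists_sub_algebraMap_mem_map (x : AdicCompletion l A) :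
    ∃ a : A, x - algebraMap A (AdicCompletion l A) a ∈
      l.map (algebraMap A (AdicCompletion l A)) := by
  obtain ⟨a, ha⟩ := Ideal.Quotient.mk_surjective (AdicCompletion.evalOneₐ l x)
  refine ⟨a, ?_⟩
  rw [← AdicCompletion.ker_evalOneₐ_eq_map l (IsNoetherian.noetherian l), RingHom.mem_ker, map_sub,
    sub_eq_zero]
  exact ha.symm.trans ((AdicCompletion.evalOneₐ l).commutes a).symm

theorem AdicCompletion.map_algebraMap_isMaximal [l.IsMaximal] :
    (l.map (algebraMap A (AdicCompletion l A))).IsMaximal :=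
  AdicCompletion.isMaximal_map_of_le l l le_rfl (IsNoetherian.noetherian l)

theorem AdicCompletion.map_algebraMap_le_jacobson_bot :
    l.map (algebraMap A (AdicCompletion l A)) ≤ (⊥ : Ideal (AdicCompletion l A)).jacobson :=
  have := AdicCompletion.isAdicComplete_self l (IsNoetherian.noetherian l)
  IsAdicComplete.le_jacobson_bot _

theorem AdicCompletion.isUnit_algebraMap_of_notMem [l.IsMaximal] {a : A} (ha : a ∉ l) :
    IsUnit (algebraMap A (AdicCompletion l A) a) := by
  have hmax := AdicCompletion.map_algebraMap_isMaximal l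
  have := AdicCompletion.isAdicComplete_self l (IsNoetherian.noetherian l)
  have hloc := isLocalRing_of_isAdicComplete_maximal (l.map (algebraMap A (AdicCompletion l A)))
  rw [← not_not (a := IsUnit _), ← mem_nonunits_iff, ← IsLocalRing.mem_maximalIdeal,
    ← IsLocalRing.eq_maximalIdeal hmax,
    ← AdicCompletion.ker_evalOneₐ_eq_map l (IsNoetherian.noetherian l), RingHom.mem_ker]
  intro h
  exact ha (Ideal.Quotient.eq_zero_iff_mem.1
    (((AdicCompletion.evalOneₐ l).commutes a).symm.trans h))

/-- If `1 ⊗ x` lies in the base change of `N` to the completion at `l`, then `x` lies in the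
localization of `N` at `l`. -/
theorem exists_notMem_smul_mem_of_mem_baseChange [l.IsMaximal] {M : Type*} [AddCommGroup M]
    [Module A M] (N : Submodule A M) (x : M)
    (hx : (1 : AdicCompletion l A) ⊗ₜ[A] x ∈ N.baseChange (AdicCompletion l A)) :
    ∃ a ∉ l, a • x ∈ N := by
  by_contra! hcon
  let y : M ⧸ N := N.mkQ x
  have hy : (1 : AdicCompletion l A) ⊗ₜ[A] y = 0 := by
    have : N.baseChange (AdicCompletion l A) ≤
        LinearMap.ker (N.mkQ.baseChange (AdicCompletion l A)) := by
      rw [Submodule.baseChange_eq_span, Submodule.span_le]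
      rintro _ ⟨n, hn, rfl⟩
      simp only [TensorProduct.mk_apply, SetLike.mem_coe, LinearMap.mem_ker,
        LinearMap.baseChange_tmul]
      rw [Submodule.mkQ_apply, (Submodule.Quotient.mk_eq_zero N).2 hn, TensorProduct.tmul_zero]
    have := this hx
    rwa [LinearMap.mem_ker, LinearMap.baseChange_tmul] at this
  -- If the annihilator `I` of the class of `x` were contained in `l`, then `A/I` would embed in
  -- `M/N`. By flatness `1 ⊗ 1` would vanish in the completion tensored with `A/I`, yet it maps to
  -- `1` in `A/l`.
  let I : Ideal A := LinearMap.ker (LinearMap.toSpanSingleton A (M ⧸ N) y)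
  have hI : I ≤ l := by
    intro a ha
    by_contra hal
    refine hcon a hal ?_
    have h : a • y = 0 := by simpa [I] using ha
    rwa [← map_smul, Submodule.mkQ_apply, Submodule.Quotient.mk_eq_zero] at h
  let f : (A ⧸ I) →ₗ[A] M ⧸ N := I.liftQ (LinearMap.toSpanSingleton A (M ⧸ N) y) le_rfl
  have hf : Function.Injective f := by
    rw [← LinearMap.ker_eq_bot]
    exact Submodule.ker_liftQ_eq_bot _ _ _ le_rfl
  have hinj := Module.Flat.lTensor_preserves_injective_linearMap (M := AdicCompletion l A) f hf
  have h1 : (1 : AdicCompletion l A) ⊗ₜ[A] (1 : A ⧸ I) = 0 := by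
    apply hinj
    rw [map_zero, LinearMap.lTensor_tmul]
    convert! hy
    exact (Submodule.liftQ_apply _ _ (1 : A)).trans (by simp)
  let g : (A ⧸ I) →ₗ[A] A ⧸ l := Submodule.mapQ I l LinearMap.id hI
  have h2 := congrArg (TensorProduct.lift ((LinearMap.mul A (A ⧸ l)).compl₁₂
    (AdicCompletion.evalOneₐ l).toLinearMap g)) h1
  rw [map_zero, TensorProduct.lift.tmul] at h2
  have h3 : g 1 = 1 := rfl
  simp [h3] at h2

variable {E : Type*} [CommRing E] [Algebra A E]

/-- Modulo the extension of `l`, every element of the completion is congruent to one of `A`.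
Surjectivity is enough, since being principal and being Artinian both pass to quotients. -/
theorem surjective_quotient_completion :
    ∃ f : E ⧸ l.map (algebraMap A E) →+* (AdicCompletion l A ⊗[A] E) ⧸
      (l.map (algebraMap A (AdicCompletion l A))).map
        (algebraMap (AdicCompletion l A) (AdicCompletion l A ⊗[A] E)),
      Function.Surjective f := by
  set J := (l.map (algebraMap A (AdicCompletion l A))).map
        (algebraMap (AdicCompletion l A) (AdicCompletion l A ⊗[A] E)) with hJ
  let i : E →+* AdicCompletion l A ⊗[A] E :=
    (Algebra.TensorProduct.includeRight : E →ₐ[A] AdicCompletion l A ⊗[A] E).toRingHom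
  have hi : i.comp (algebraMap A E) = (algebraMap (AdicCompletion l A)
      (AdicCompletion l A ⊗[A] E)).comp (algebraMap A (AdicCompletion l A)) := by
    ext a
    exact (Algebra.TensorProduct.includeRight :
      E →ₐ[A] AdicCompletion l A ⊗[A] E).commutes a
  have hle : l.map (algebraMap A E) ≤ J.comap i := by
    rw [← Ideal.map_le_iff_le_comap, Ideal.map_map, hi, ← Ideal.map_map]
  refine ⟨Ideal.quotientMap J i hle, fun y => ?_⟩
  obtain ⟨y, rfl⟩ := Ideal.Quotient.mk_surjective y
  change _ ∈ (Ideal.quotientMap J i hle).rangeS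
  induction y using TensorProduct.induction_on with
  | zero => rw [map_zero]; exact zero_mem _
  | add x y hx hy => rw [RingHom.map_add]; exact add_mem hx hy
  | tmul x e =>
    obtain ⟨a, ha⟩ := AdicCompletion.exists_sub_algebraMap_mem_map l x
    refine ⟨Ideal.Quotient.mk _ (a • e), ?_⟩
    rw [Ideal.quotientMap_mk, eq_comm, Ideal.Quotient.eq]
    have : x ⊗ₜ[A] e - i (a • e) = algebraMap _ (AdicCompletion l A ⊗[A] E)
        (x - algebraMap A (AdicCompletion l A) a) * (1 ⊗ₜ e) := by
      rw [Algebra.TensorProduct.algebraMap_apply, Algebra.TensorProduct.tmul_mul_tmul,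
        mul_one, one_mul, Algebra.algebraMap_self_apply, TensorProduct.sub_tmul,
        Algebra.algebraMap_eq_smul_one, TensorProduct.smul_tmul]
      rfl
    rw [this]
    exact Ideal.mul_mem_right _ _ (Ideal.mem_map_of_mem _ ha)

theorem isGorensteinAlgebra_completion_of_isPrincipalIdealRing [l.IsMaximal] [Module.Finite A E]
    [Module.Flat A E]
    (h : IsPrincipalIdealRing ((AdicCompletion l A ⊗[A] E) ⧸
      (l.map (algebraMap A (AdicCompletion l A))).map
        (algebraMap (AdicCompletion l A) (AdicCompletion l A ⊗[A] E)))) :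
    IsGorensteinAlgebra (l.map (algebraMap A (AdicCompletion l A)))
      (AdicCompletion l A ⊗[A] E) where
  comm := mul_comm
  finite := inferInstance
  flat := inferInstance
  local_gorenstein M hM := by
    have hart : IsArtinianRing ((AdicCompletion l A ⊗[A] E) ⧸
        (l.map (algebraMap A (AdicCompletion l A))).map
        (algebraMap (AdicCompletion l A) (AdicCompletion l A ⊗[A] E))) := by
      have := isArtinianRing_quotient_map l (E := E)
      obtain ⟨f, hf⟩ := surjective_quotient_completion l (E := E)
      exact hf.isArtinianRing
    refine finrank_socle_localization_eq_one ((l.map (algebraMap A (AdicCompletion l A))).map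
      (algebraMap (AdicCompletion l A) (AdicCompletion l A ⊗[A] E))) M ?_ _ ?_
    · rw [Ideal.map_le_iff_le_comap]
      -- By integrality `M` contracts to a maximal ideal of the completion, which contains the
      -- Jacobson radical and hence the extension of `l`.
      refine (AdicCompletion.map_algebraMap_le_jacobson_bot l).trans ?_
      have : Algebra.IsIntegral (AdicCompletion l A) (AdicCompletion l A ⊗[A] E) :=
        Algebra.IsIntegral.of_finite _ _
      have := Ideal.isMaximal_comap_of_isIntegral_of_isMaximal (R := AdicCompletion l A) M
      exact sInf_le ⟨bot_le, this⟩
    · rw [Ideal.map_map (algebraMap (AdicCompletion l A) (AdicCompletion l A ⊗[A] E)),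
        ← IsScalarTower.algebraMap_eq]

theorem isGorensteinAlgebra_completion_of_quotient [l.IsMaximal] [Module.Finite A E]
    [Module.Flat A E] (h : IsPrincipalIdealRing (E ⧸ l.map (algebraMap A E))) :
    IsGorensteinAlgebra (l.map (algebraMap A (AdicCompletion l A)))
      (AdicCompletion l A ⊗[A] E) := by
  obtain ⟨f, hf⟩ := surjective_quotient_completion l (E := E)
  exact isGorensteinAlgebra_completion_of_isPrincipalIdealRing l
    (IsPrincipalIdealRing.of_surjective f hf)

theorem isGorensteinAlgebra_completion_of_adjoin_eq_top [l.IsMaximal] [Module.Finite A E]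
    [Module.Flat A E] (x : AdicCompletion l A ⊗[A] E)
    (h : Algebra.adjoin (AdicCompletion l A) {x} = ⊤) :
    IsGorensteinAlgebra (l.map (algebraMap A (AdicCompletion l A)))
      (AdicCompletion l A ⊗[A] E) :=
  have := AdicCompletion.map_algebraMap_isMaximal l
  isGorensteinAlgebra_completion_of_isPrincipalIdealRing l
    (isPrincipalIdealRing_quotient_map_of_adjoin_eq_top _ x h)

end Completion

/-! ### Finite algebras whose reduction is a principal ideal ring -/

/-- Any `x` outside the image of `κ` spans with `1` a plane, so `κ[x]` is everything and `Q` is a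
quotient of `κ[X]`; if there is no such `x`, `Q` is a quotient of `κ`. -/
theorem isPrincipalIdealRing_of_finrank_le_two {κ Q : Type*} [Field κ] [CommRing Q] [Algebra κ Q]
    [Module.Finite κ Q] (h : Module.finrank κ Q ≤ 2) : IsPrincipalIdealRing Q := by
  rcases subsingleton_or_nontrivial Q with hQ | hQ
  · exact ⟨fun I => ⟨0, Subsingleton.elim _ _⟩⟩
  by_cases hx : ∃ x : Q, x ∉ (⊥ : Subalgebra κ Q)
  · obtain ⟨x, hx⟩ := hx
    have hlt : (⊥ : Subalgebra κ Q) < Algebra.adjoin κ {x} := by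
      refine lt_of_le_of_ne bot_le fun h => hx ?_
      rw [h]
      exact Algebra.self_mem_adjoin_singleton κ x
    have h1 : 2 ≤ Module.finrank κ (Algebra.adjoin κ {x}) := by
      have := Submodule.finrank_lt_finrank_of_lt
        ((OrderEmbedding.lt_iff_lt (Subalgebra.toSubmodule (R := κ) (A := Q))).2 hlt)
      have h1 : Module.finrank κ (Subalgebra.toSubmodule (⊥ : Subalgebra κ Q)) = 1 :=
        Subalgebra.finrank_bot
      rw [h1] at this
      exact this
    have htop : Algebra.adjoin κ {x} = ⊤ := by
      apply Algebra.toSubmodule_eq_top.1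
      apply Submodule.eq_top_of_finrank_eq
      exact le_antisymm (Submodule.finrank_le _) (h.trans h1)
    refine IsPrincipalIdealRing.of_surjective (Polynomial.aeval (R := κ) x) fun y => ?_
    rw [← AlgHom.mem_range, ← Algebra.adjoin_singleton_eq_range_aeval, htop]
    exact Algebra.mem_top
  · push Not at hx
    exact IsPrincipalIdealRing.of_surjective (algebraMap κ Q) fun y => Algebra.mem_bot.1 (hx y :
      y ∈ (⊥ : Subalgebra κ Q))

theorem isPrincipalIdealRing_quotient_map_of_card_le_two {A E : Type*} [CommRing A] [CommRing E]
    [Algebra A E] (l : Ideal A) [l.IsMaximal] {ι : Type*} [Fintype ι]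
    (hι : Fintype.card ι ≤ 2) (b : ι → E) (hb : Submodule.span A (Set.range b) = ⊤) :
    IsPrincipalIdealRing (E ⧸ l.map (algebraMap A E)) := by
  let := Ideal.Quotient.field l
  set J := l.map (algebraMap A E)
  let c : ι → E ⧸ J := fun i => Ideal.Quotient.mk J (b i)
  have hc : Submodule.span (A ⧸ l) (Set.range c) = ⊤ := by
    rw [eq_top_iff]
    rintro y -
    obtain ⟨y, rfl⟩ := Ideal.Quotient.mk_surjective y
    have hy : y ∈ Submodule.span A (Set.range b) := hb ▸ Submodule.mem_top
    induction hy using Submodule.span_induction with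
    | mem y hy =>
      obtain ⟨i, rfl⟩ := hy
      exact Submodule.subset_span ⟨i, rfl⟩
    | zero => rw [map_zero]; exact zero_mem _
    | add x y _ _ hx hy => rw [map_add]; exact add_mem hx hy
    | smul a y _ hy => exact Submodule.smul_mem _ (Ideal.Quotient.mk l a) hy
  have hfin : Module.Finite (A ⧸ l) (E ⧸ J) :=
    ⟨Submodule.fg_def.2 ⟨_, Set.finite_range c, hc⟩⟩
  refine isPrincipalIdealRing_of_finrank_le_two (κ := A ⧸ l) ?_
  rw [← finrank_top, ← hc]
  exact (finrank_range_le_card c).trans hι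

/-- A nonzero integral element divides a nonzero element of `A`, so denominators can be taken in
`A`. -/
theorem FractionRing.exists_eq_div_algebraMap {A E : Type*} [CommRing A] [CommRing E] [IsDomain E]
    [Algebra A E] [FaithfulSMul A E] [Algebra.IsIntegral A E] [Nontrivial A]
    (x : FractionRing E) :
    ∃ (a : A) (e : E), a ≠ 0 ∧
      x = algebraMap E (FractionRing E) e / algebraMap E (FractionRing E) (algebraMap A E a) := by
  obtain ⟨e, e₀, h0, rfl⟩ := IsFractionRing.div_surjective (A := E) x
  have h0' : e₀ ≠ 0 := nonZeroDivisors.ne_zero h0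
  obtain ⟨a, ha, ha0⟩ := Submodule.exists_mem_ne_zero_of_ne_bot
    (Ideal.comap_ne_bot_of_integral_mem (I := Ideal.span {e₀}) h0'
      (Ideal.mem_span_singleton_self e₀) (Algebra.IsIntegral.isIntegral (R := A) e₀))
  obtain ⟨t, ht⟩ := Ideal.mem_span_singleton.1 (Ideal.mem_comap.1 ha)
  have ht0 : t ≠ 0 := by
    rintro rfl
    rw [mul_zero] at ht
    exact ha0 (FaithfulSMul.algebraMap_injective A E (ht.trans (map_zero _).symm))
  refine ⟨a, e * t, ha0, ?_⟩
  rw [ht, map_mul, map_mul, mul_div_mul_right]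
  simpa using ht0

/-- The hypothesis says that an integral fraction `e/a` lies in the localization `C` of `E` at `A ∖
l`. Hence `C` is a Dedekind domain with finitely many maximal ideals, so it is principal, and `E/lE`
is a quotient of `C`. -/
theorem isPrincipalIdealRing_quotient_map_of_integrallyClosed {A E : Type*} [CommRing A]
    [IsDomain A] [IsNoetherianRing A] [Ring.DimensionLEOne A] [CommRing E] [IsDomain E]
    [Algebra A E] [Module.Finite A E] [FaithfulSMul A E] (l : Ideal A) [l.IsMaximal]
    (h : ∀ (a : A) (e : E), a ≠ 0 → IsIntegral A
      (algebraMap E (FractionRing E) e / algebraMap E (FractionRing E) (algebraMap A E a)) →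
      ∃ s ∉ l, ∃ e' : E, s • e = a • e') :
    IsPrincipalIdealRing (E ⧸ l.map (algebraMap A E)) := by
  set Q := FractionRing E
  set S := Algebra.algebraMapSubmonoid E l.primeCompl with hS
  have hint : Algebra.IsIntegral A E := Algebra.IsIntegral.of_finite A E
  have hinj : Function.Injective (algebraMap A E) := FaithfulSMul.algebraMap_injective A E
  have hSle : S ≤ nonZeroDivisors E := by
    rintro _ ⟨s, hs, rfl⟩
    refine mem_nonZeroDivisors_of_ne_zero fun h0 => hs ?_
    rw [hinj (h0.trans (map_zero _).symm)]
    exact zero_mem l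
  set C := Localization S
  have : IsDomain C := IsLocalization.isDomain_localization hSle
  have : IsNoetherianRing C := IsLocalization.isNoetherianRing S C
    (IsNoetherianRing.of_finite A E)
  have hdimE : Ring.DimensionLEOne E := ⟨fun {p} hp0 hp => by
    have : (p.comap (algebraMap A E)).IsMaximal :=
      (Ideal.IsPrime.isMaximal inferInstance fun h0 => hp0 (Ideal.eq_bot_of_comap_eq_bot h0))
    exact Ideal.isMaximal_of_isIntegral_of_isMaximal_comap p this⟩
  have : Ring.DimensionLEOne C := Ring.DimensionLEOne.localization C hSle
  have : IsIntegrallyClosed C := by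
    let := IsLocalization.localizationAlgebraOfSubmonoidLe C Q S (nonZeroDivisors E) hSle
    have := IsLocalization.localization_isScalarTower_of_submonoid_le C Q S (nonZeroDivisors E) hSle
    have : IsFractionRing C Q := IsFractionRing.isFractionRing_of_isDomain_of_isLocalization S C Q
    rw [isIntegrallyClosed_iff Q]
    intro x hx
    obtain ⟨⟨_, m, hm, rfl⟩, hmx⟩ := hx.exists_multiple_integral_of_isLocalization S
    replace hmx : IsIntegral A (algebraMap E Q (algebraMap A E m) * x) := by
      have := isIntegral_trans (R := A) _ hmx
      rwa [Submonoid.smul_def, Algebra.smul_def] at this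
    obtain ⟨a, e, ha, he⟩ := FractionRing.exists_eq_div_algebraMap (A := A)
      (algebraMap E Q (algebraMap A E m) * x)
    rw [he] at hmx
    obtain ⟨s, hs, e', hse⟩ := h a e ha hmx
    have hne {b : A} (hb : b ≠ 0) : algebraMap E Q (algebraMap A E b) ≠ 0 := by
      simpa using hb
    have hl0 {b : A} (hb : b ∉ l) : b ≠ 0 := fun h0 => hb (h0 ▸ zero_mem l)
    let t : S := ⟨algebraMap A E s, s, hs, rfl⟩ * ⟨algebraMap A E m, m, hm, rfl⟩
    refine ⟨IsLocalization.mk' C e' t, ?_⟩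
    have h1 := congrArg (algebraMap C Q) (IsLocalization.mk'_spec' C e' t)
    rw [map_mul, ← IsScalarTower.algebraMap_apply, ← IsScalarTower.algebraMap_apply] at h1
    have h2 := congrArg (algebraMap E Q) hse
    rw [Algebra.smul_def, Algebra.smul_def, map_mul, map_mul] at h2
    rw [eq_div_iff (hne ha)] at he
    have h3 : algebraMap E Q t = algebraMap E Q (algebraMap A E s) *
      algebraMap E Q (algebraMap A E m) := map_mul _ _ _
    rw [h3] at h1
    apply mul_left_cancel₀ (mul_ne_zero (mul_ne_zero (hne (hl0 hs)) (hne (hl0 hm))) (hne ha))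
    linear_combination algebraMap E Q (algebraMap A E a) * h1 - h2 -
      algebraMap E Q (algebraMap A E s) * he
  have : IsDedekindDomain C := {}
  have : IsPrincipalIdealRing C := by
    apply IsPrincipalIdealRing.of_finite_maximals
    have hfin : {I : Ideal E | I.IsPrime ∧ l.map (algebraMap A E) ≤ I}.Finite := by
      have := isArtinianRing_quotient_map l (E := E)
      refine ((IsArtinianRing.setOfPred_isPrime_finite (E ⧸ l.map (algebraMap A E))).image
        (Ideal.comap (Ideal.Quotient.mk _))).subset ?_
      rintro I ⟨hI, hle⟩
      refine ⟨I.map (Ideal.Quotient.mk _), Ideal.map_isPrime_of_surjective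
        Ideal.Quotient.mk_surjective (by rwa [Ideal.mk_ker]), ?_⟩
      rw [Ideal.comap_map_of_surjective' _ Ideal.Quotient.mk_surjective, Ideal.mk_ker,
        sup_eq_left.2 hle]
    -- A maximal ideal of `C` contracts either to zero or to a prime over `l`, and the latter
    -- correspond to primes of the Artinian ring `E/lE`. Adding `⊥` to the target covers the zero
    -- case without excluding it.
    refine Set.Finite.of_injOn (f := Ideal.comap (algebraMap E C)) (t := insert ⊥ _) ?_ ?_
      (hfin.insert ⊥)
    · intro I hI
      have hI : I.IsMaximal := hI
      by_cases h0 : I.comap (algebraMap E C) = ⊥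
      · exact Or.inl h0
      refine Or.inr ⟨inferInstance, ?_⟩
      rw [Ideal.map_le_iff_le_comap]
      have hle : (I.comap (algebraMap E C)).comap (algebraMap A E) ≤ l := by
        intro a ha
        by_contra hal
        refine hI.ne_top (Ideal.eq_top_of_isUnit_mem _ ha ?_)
        exact IsLocalization.map_units C (⟨algebraMap A E a, a, hal, rfl⟩ : S)
      refine (Ideal.IsMaximal.eq_of_le (Ideal.IsPrime.isMaximal inferInstance fun h1 => h0
        (Ideal.eq_bot_of_comap_eq_bot h1)) (Ideal.IsPrime.ne_top inferInstance) hle).ge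
    · intro I _ I' _ h
      rw [← IsLocalization.map_under S C I, ← IsLocalization.map_under S C I']
      exact congrArg _ h
  let g : C →+* E ⧸ l.map (algebraMap A E) := IsLocalization.lift (M := S)
    (g := Ideal.Quotient.mk (l.map (algebraMap A E))) (by
      rintro ⟨_, s, hs, rfl⟩
      obtain ⟨t, i, hi, hti⟩ := Ideal.IsMaximal.exists_inv ‹l.IsMaximal› hs
      refine IsUnit.of_mul_eq_one (Ideal.Quotient.mk _ (algebraMap A E t)) ?_
      rw [← map_mul, ← map_mul, mul_comm, ← map_one (Ideal.Quotient.mk _), Ideal.Quotient.eq,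
        eq_sub_of_add_eq hti, map_sub, map_one, sub_sub_cancel_left]
      exact neg_mem (Ideal.mem_map_of_mem _ hi))
  refine IsPrincipalIdealRing.of_surjective g fun y => ?_
  obtain ⟨y, rfl⟩ := Ideal.Quotient.mk_surjective y
  exact ⟨algebraMap E C y, IsLocalization.lift_eq _ _⟩

/-! ### Endomorphisms commuting with a nonderogatory endomorphism -/

section Nonderogatory

variable {L W : Type*} [Field L] [AddCommGroup W] [Module L W]

theorem Module.End.exists_span_range_pow_apply_eq_top [FiniteDimensional L W] (f : Module.End L W)
    {r : ℕ}
    (hr : Module.finrank L W ≤ r) (hf : LinearIndependent L fun i : Fin r => f ^ (i : ℕ)) :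
    ∃ w : W, Submodule.span L (Set.range fun i : Fin r => (f ^ (i : ℕ)) w) = ⊤ := by
  -- A vector whose annihilator in `L[X]` is that of the whole space: a polynomial in `f` of degree
  -- below `r` that kills it is zero as an operator, hence trivial by `hf`.
  obtain ⟨x, hx⟩ := Module.exists_ker_toSpanSingleton_eq_annihilator L[X] (Module.AEval' f)
  obtain ⟨w, rfl⟩ := (Module.AEval'.of f).surjective x
  refine ⟨w, ?_⟩
  have hli : LinearIndependent L fun i : Fin r => (f ^ (i : ℕ)) w := by
    rw [Fintype.linearIndependent_iff] at hf ⊢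
    intro c hc
    apply hf c
    let p : L[X] := ∑ i : Fin r, Polynomial.C (c i) * Polynomial.X ^ (i : ℕ)
    have hp : Polynomial.aeval f p = ∑ i, c i • f ^ (i : ℕ) := by
      simp [p, Algebra.smul_def]
    rw [← hp]
    have hpw : p ∈ LinearMap.ker (LinearMap.toSpanSingleton L[X] _ (Module.AEval'.of f w)) := by
      rw [LinearMap.mem_ker, LinearMap.toSpanSingleton_apply, ← Module.AEval.of_aeval_smul, hp,
        Module.End.smul_def, LinearMap.sum_apply]
      simp only [LinearMap.smul_apply, hc, map_zero]
    rw [hx, Module.mem_annihilator] at hpw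
    ext v
    have := hpw (Module.AEval'.of f v)
    rw [← Module.AEval.of_aeval_smul] at this
    exact (Module.AEval'.of f).map_eq_zero_iff.1 this
  refine hli.span_eq_top_of_card_eq_finrank' (le_antisymm hli.fintype_card_le_finrank ?_)
  rwa [Fintype.card_fin]

variable {f : Module.End L W} {r : ℕ} {w : W}

theorem Module.End.eq_zero_of_commute_of_apply_eq_zero
    (hw : Submodule.span L (Set.range fun i : Fin r => (f ^ (i : ℕ)) w) = ⊤) {g : Module.End L W}
    (hg : Commute f g) (h0 : g w = 0) : g = 0 := by
  apply LinearMap.ext_on_range (v := fun i : Fin r => (f ^ (i : ℕ)) w) hw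
  intro i
  rw [← Module.End.mul_apply, ← (hg.pow_left i).eq, Module.End.mul_apply, h0, map_zero]
  rfl

/-- An operator commuting with `f` is determined by its value at the cyclic vector `w`, so it is a
polynomial in `f`. -/
theorem Module.End.commute_of_commute_of_span_eq_top
    (hw : Submodule.span L (Set.range fun i : Fin r => (f ^ (i : ℕ)) w) = ⊤)
    {g h : Module.End L W} (hg : Commute f g) (hh : Commute f h) : Commute g h := by
  obtain ⟨c, hc⟩ := (Submodule.mem_span_range_iff_exists_fun L).1
    (hw ▸ Submodule.mem_top : g w ∈ Submodule.span L (Set.range fun i : Fin r => (f ^ (i : ℕ)) w))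
  have hpow : Commute f (∑ i : Fin r, c i • f ^ (i : ℕ)) :=
    Commute.sum_right _ _ _ fun i _ => ((Commute.refl f).pow_right _).smul_right _
  have hgeq : g = ∑ i : Fin r, c i • f ^ (i : ℕ) := by
    rw [← sub_eq_zero]
    refine Module.End.eq_zero_of_commute_of_apply_eq_zero hw (hg.sub_right hpow) ?_
    rw [LinearMap.sub_apply, LinearMap.sum_apply, ← hc, sub_eq_zero]
    rfl
  rw [hgeq]
  exact Commute.sum_left _ _ _ fun i _ => (hh.pow_left _).smul_left _

theorem Module.End.card_le_finrank_of_commute [FiniteDimensional L W]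
    (hw : Submodule.span L (Set.range fun i : Fin r => (f ^ (i : ℕ)) w) = ⊤)
    {ι : Type*} [Fintype ι] {g : ι → Module.End L W} (hg : ∀ i, Commute f (g i))
    (hli : LinearIndependent L g) : Fintype.card ι ≤ Module.finrank L W := by
  suffices LinearIndependent L fun i => g i w from this.fintype_card_le_finrank
  rw [Fintype.linearIndependent_iff] at hli ⊢
  intro c hc
  refine hli c (Module.End.eq_zero_of_commute_of_apply_eq_zero hw
    (Commute.sum_right _ _ _ fun i _ => (hg i).smul_right _) ?_)
  rw [LinearMap.sum_apply]
  exact hc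

end Nonderogatory

/-! ### Extension of endomorphisms to the fraction field -/

section Extension

variable {R V : Type*} [CommRing R] [IsDomain R] [AddCommGroup V] [Module R V]
  {K W : Type*} [Field K] [Algebra R K] [IsFractionRing R K] [AddCommGroup W] [Module K W]
  (j : V →ₛₗ[algebraMap R K] W) (hj : Function.Injective j)
  (hspan : Submodule.span K (Set.range j) = ⊤) (ψ : Module.End R V →+* Module.End K W)
  (hψ : ∀ h v, ψ h (j v) = j (h v))

include hspan in
omit [IsDomain R] [IsFractionRing R K] in
theorem span_range_comp_eq_top {r : ℕ} {b : Fin r → V}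
    (hb : Submodule.span R (Set.range b) = ⊤) :
    Submodule.span K (Set.range fun i => j (b i)) = ⊤ := by
  rw [eq_top_iff, ← hspan, Submodule.span_le]
  rintro _ ⟨v, rfl⟩
  obtain ⟨c, rfl⟩ := (Submodule.mem_span_range_iff_exists_fun R).1
    (hb ▸ Submodule.mem_top : v ∈ Submodule.span R (Set.range b))
  rw [map_sum]
  refine sum_mem fun i _ => ?_
  rw [LinearMap.map_smulₛₗ]
  exact Submodule.smul_mem _ _ (Submodule.subset_span ⟨i, rfl⟩)

include hj hψ in
omit [IsDomain R] [IsFractionRing R K] in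
theorem Module.End.extension_injective : Function.Injective ψ := by
  refine (injective_iff_map_eq_zero _).2 fun g hg => ?_
  ext v
  apply hj
  rw [← hψ, hg, LinearMap.zero_apply, LinearMap.zero_apply, map_zero]

include hj hψ in
theorem LinearIndependent.end_extension {ι : Type*} {g : ι → Module.End R V}
    (hg : LinearIndependent R g) : LinearIndependent K fun i => ψ (g i) := by
  rw [linearIndependent_iff'] at hg ⊢
  intro s c hc i hi
  classical
  -- A common denominator `d` turns the relation over `K` into one over `R`, which is tested on the
  -- image of `V`.
  obtain ⟨d, hd⟩ := IsLocalization.exist_integer_multiples_of_finset (nonZeroDivisors R)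
    (s.image c)
  choose! a ha using fun j (hj : j ∈ s) => hd (c j) (Finset.mem_image_of_mem c hj)
  have hsum : ∑ j ∈ s, a j • g j = 0 := by
    ext v
    apply hj
    have h := LinearMap.congr_fun hc (j v)
    rw [LinearMap.sum_apply] at h
    have h' := congrArg (algebraMap R K d • ·) h
    simp only [Finset.smul_sum, LinearMap.zero_apply, smul_zero] at h'
    rw [LinearMap.sum_apply, LinearMap.zero_apply, map_zero, map_sum, ← h']
    refine Finset.sum_congr rfl fun i hi => ?_
    rw [LinearMap.smul_apply, LinearMap.smul_apply, LinearMap.map_smulₛₗ, hψ, ha i hi,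
      Algebra.smul_def, mul_smul]
  have h0 := ha i hi
  rw [hg s a hsum i hi, map_zero] at h0
  exact (smul_eq_zero.1 h0.symm).resolve_left (nonZeroDivisors.coe_ne_zero d)

end Extension

section TorsionFree

universe u v

variable {R : Type u} {V : Type v} [CommRing R] [IsDomain R] [AddCommGroup V] [Module R V]

theorem Module.End.exists_extension [Module.IsTorsionFree R V] : ∃ (W : Type (max u v))
    (_ : AddCommGroup W) (_ : Module (FractionRing R) W)
    (j : V →ₛₗ[algebraMap R (FractionRing R)] W)
    (ψ : Module.End R V →+* Module.End (FractionRing R) W),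
    Function.Injective j ∧ Submodule.span (FractionRing R) (Set.range j) = ⊤ ∧
      ∀ h v, ψ h (j v) = j (h v) := by
  let K := FractionRing R
  let j : V →ₛₗ[algebraMap R K] K ⊗[R] V :=
    { toFun := fun v => 1 ⊗ₜ v
      map_add' := fun v w => TensorProduct.tmul_add 1 v w
      map_smul' := fun c v => by rw [algebraMap_smul, TensorProduct.tmul_smul] }
  refine ⟨K ⊗[R] V, inferInstance, inferInstance, j,
    (Module.End.baseChangeHom R K V).toRingHom, ?_, ?_, fun h v => rfl⟩
  · have : IsLocalizedModule (nonZeroDivisors R) (TensorProduct.mk R K V 1) :=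
      (isLocalizedModule_iff_isBaseChange (nonZeroDivisors R) K _).2
        (TensorProduct.isBaseChange R V K)
    refine (injective_iff_map_eq_zero (TensorProduct.mk R K V 1)).2 fun v hv => ?_
    obtain ⟨c, hc⟩ := (IsLocalizedModule.eq_zero_iff (nonZeroDivisors R) _).1 hv
    exact (smul_eq_zero.1 hc).resolve_left (nonZeroDivisors.coe_ne_zero c)
  · rw [eq_top_iff]
    rintro x -
    induction x using TensorProduct.induction_on with
    | zero => exact zero_mem _
    | add x y hx hy => exact add_mem hx hy
    | tmul c v =>
      have : c ⊗ₜ[R] v = c • j v := by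
        change _ = c • ((1 : K) ⊗ₜ[R] v)
        rw [TensorProduct.smul_tmul', smul_eq_mul, mul_one]
      rw [this]
      exact Submodule.smul_mem _ _ (Submodule.subset_span ⟨v, rfl⟩)

variable [Module.IsTorsionFree R V] {r : ℕ} {b : Fin r → V} {f : Module.End R V}

theorem Module.End.commute_of_commute_of_linearIndependent_pow
    (hb : Submodule.span R (Set.range b) = ⊤)
    (hf : LinearIndependent R fun i : Fin r => f ^ (i : ℕ)) {g h : Module.End R V}
    (hg : Commute f g) (hh : Commute f h) : Commute g h := by
  obtain ⟨W, _, _, j, ψ, hj, hspan, hψ⟩ := Module.End.exists_extension (R := R) (V := V)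
  have hspan' := span_range_comp_eq_top j hspan hb
  have : FiniteDimensional (FractionRing R) W :=
    ⟨Submodule.fg_def.2 ⟨_, Set.finite_range _, hspan'⟩⟩
  have hr : Module.finrank (FractionRing R) W ≤ r := by
    rw [← finrank_top, ← hspan']
    exact (finrank_range_le_card _).trans (by simp)
  obtain ⟨w, hw⟩ := Module.End.exists_span_range_pow_apply_eq_top (ψ f) hr
    (by simpa only [map_pow] using hf.end_extension j hj ψ hψ)
  apply Module.End.extension_injective j hj ψ hψ
  rw [map_mul, map_mul]
  exact Module.End.commute_of_commute_of_span_eq_top hw (hg.map _) (hh.map _)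

theorem Module.End.card_le_of_commute_of_linearIndependent_pow
    (hb : Submodule.span R (Set.range b) = ⊤)
    (hf : LinearIndependent R fun i : Fin r => f ^ (i : ℕ)) {ι : Type*} [Fintype ι]
    {g : ι → Module.End R V} (hg : ∀ i, Commute f (g i)) (hli : LinearIndependent R g) :
    Fintype.card ι ≤ r := by
  obtain ⟨W, _, _, j, ψ, hj, hspan, hψ⟩ := Module.End.exists_extension (R := R) (V := V)
  have hspan' := span_range_comp_eq_top j hspan hb
  have : FiniteDimensional (FractionRing R) W :=
    ⟨Submodule.fg_def.2 ⟨_, Set.finite_range _, hspan'⟩⟩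
  have hr : Module.finrank (FractionRing R) W ≤ r := by
    rw [← finrank_top, ← hspan']
    exact (finrank_range_le_card _).trans (by simp)
  obtain ⟨w, hw⟩ := Module.End.exists_span_range_pow_apply_eq_top (ψ f) hr
    (by simpa only [map_pow] using hf.end_extension j hj ψ hψ)
  exact (Module.End.card_le_finrank_of_commute hw (fun i => (hg i).map _)
    (hli.end_extension j hj ψ hψ)).trans hr

end TorsionFree

/-! ### Degrees of twisted polynomials -/

namespace TwistedPoly

variable {Fq k : Type*} [Field Fq] [Fintype Fq] [Field k] [Algebra Fq k]

/-- The coefficient of `τ ^ n`. -/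
def coeff (n : ℕ) : TwistedPoly Fq k →+ k where
  toFun u := SkewPolynomial.coeff (R := k) u n
  map_zero' := rfl
  map_add' u v := DFunLike.congr_fun (SkewMonoidAlgebra.coeff_add (k := k) u v)
    (Multiplicative.ofAdd n)

theorem coeff_const_mul_tau_pow (c : k) (m n : ℕ) :
    coeff n (const Fq k c * tau Fq k ^ m) = if m = n then c else 0 := by
  let := qFrobAction Fq k
  have h := SkewPolynomial.C_mul_X_pow_eq_monomial (R := k) (n := m) (a := c)
  refine Eq.trans ?_ (SkewPolynomial.coeff_monomial (R := k) (n := m) (m := n) (a := c))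
  exact congrArg (fun u => SkewPolynomial.coeff u n) h

theorem coeff_const_mul (c : k) (u : TwistedPoly Fq k) (n : ℕ) :
    coeff n (const Fq k c * u) = c * coeff n u := by
  induction u using TwistedPoly.induction with
  | h0 => simp
  | hadd x y hx hy => rw [mul_add, map_add, hx, hy, map_add, mul_add]
  | hmon m d =>
    rw [← mul_assoc, ← map_mul, coeff_const_mul_tau_pow, coeff_const_mul_tau_pow, mul_ite, mul_zero]

theorem coeff_mul_const_mul_tau_pow (u : TwistedPoly Fq k) (d : k) (m n : ℕ) :
    coeff n (u * (const Fq k d * tau Fq k ^ m)) =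
      if m ≤ n then coeff (n - m) u * d ^ Fintype.card Fq ^ (n - m) else 0 := by
  induction u using TwistedPoly.induction with
  | h0 => simp
  | hadd x y hx hy =>
    rw [add_mul, map_add, hx, hy, map_add]
    split_ifs <;> ring
  | hmon i c =>
    rw [mul_assoc, ← mul_assoc (tau Fq k ^ i), tau_pow_mul_const, mul_assoc, ← pow_add, ← mul_assoc,
      ← map_mul, coeff_const_mul_tau_pow, coeff_const_mul_tau_pow]
    by_cases h : i + m = n
    · subst h
      simp
    · rw [if_neg h]
      split_ifs with h1 h2
      · lia
      · rw [zero_mul]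
      · rfl

theorem eq_sum_of_coeff_eq_zero {u : TwistedPoly Fq k} {N : ℕ} (h : ∀ n, N ≤ n → coeff n u = 0) :
    u = ∑ n ∈ Finset.range N, const Fq k (coeff n u) * tau Fq k ^ n := by
  have hext (u v : TwistedPoly Fq k) (h : ∀ n, coeff n u = coeff n v) : u = v := by
    apply SkewMonoidAlgebra.ext
    exact fun n => h (Multiplicative.toAdd n)
  apply hext
  intro n
  rw [map_sum]
  simp only [coeff_const_mul_tau_pow, Finset.sum_ite_eq', Finset.mem_range]
  split_ifs with hn
  · rfl
  · exact h n (not_lt.1 hn)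

theorem exists_coeff_eq_zero (u : TwistedPoly Fq k) : ∃ N, ∀ n, N ≤ n → coeff n u = 0 := by
  induction u using TwistedPoly.induction with
  | h0 => exact ⟨0, fun n _ => map_zero _⟩
  | hadd x y hx hy =>
    obtain ⟨N, hN⟩ := hx
    obtain ⟨M, hM⟩ := hy
    refine ⟨max N M, fun n hn => ?_⟩
    rw [map_add, hN n (le_of_max_le_left hn), hM n (le_of_max_le_right hn), add_zero]
  | hmon i c =>
    refine ⟨i + 1, fun n hn => ?_⟩
    rw [coeff_const_mul_tau_pow, if_neg (by lia)]

/-- `u = c τ ^ n + (terms of lower degree)`. -/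
def HasLeadingTerm (u : TwistedPoly Fq k) (n : ℕ) (c : k) : Prop :=
  coeff n u = c ∧ ∀ i, n < i → coeff i u = 0

theorem HasLeadingTerm.ne_zero {u : TwistedPoly Fq k} {n : ℕ} {c : k} (h : HasLeadingTerm u n c)
    (hc : c ≠ 0) : u ≠ 0 := by
  rintro rfl
  exact hc (h.1.symm.trans (map_zero _))

theorem exists_hasLeadingTerm {u : TwistedPoly Fq k} (hu : u ≠ 0) :
    ∃ n c, c ≠ 0 ∧ HasLeadingTerm u n c := by
  classical
  have hex := exists_coeff_eq_zero u
  have hspec := Nat.find_spec hex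
  rcases h : Nat.find hex with _ | n
  · rw [h] at hspec
    refine absurd ?_ hu
    rw [eq_sum_of_coeff_eq_zero hspec, Finset.range_zero, Finset.sum_empty]
  · rw [h] at hspec
    refine ⟨n, coeff n u, fun h0 => ?_, rfl, fun i hi => hspec i hi⟩
    refine Nat.find_min hex (m := n) (by lia) fun i hi => ?_
    rcases hi.eq_or_lt with rfl | hi
    · exact h0
    · exact hspec i hi

theorem HasLeadingTerm.mul {u v : TwistedPoly Fq k} {n m : ℕ} {c d : k}
    (hu : HasLeadingTerm u n c) (hv : HasLeadingTerm v m d) :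
    HasLeadingTerm (u * v) (n + m) (c * d ^ Fintype.card Fq ^ n) := by
  have hsum (i : ℕ) : coeff i (u * v) = ∑ j ∈ Finset.range (m + 1),
      if j ≤ i then coeff (i - j) u * (coeff j v) ^ Fintype.card Fq ^ (i - j) else 0 := by
    rw [eq_sum_of_coeff_eq_zero (u := v) (N := m + 1) fun i hi => hv.2 i hi, Finset.mul_sum,
      map_sum]
    -- The previous rewrite also expanded `v` on the right-hand side; this folds those copies back.
    rw [← eq_sum_of_coeff_eq_zero (u := v) (N := m + 1) fun i hi => hv.2 i hi]
    simp only [coeff_mul_const_mul_tau_pow]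
  constructor
  · rw [hsum, Finset.sum_eq_single m]
    · rw [if_pos (by lia), Nat.add_sub_cancel, hu.1, hv.1]
    · intro j hj hjm
      rw [Finset.mem_range] at hj
      rw [if_pos (by lia), hu.2 _ (by lia), zero_mul]
    · simp
  · intro i hi
    rw [hsum]
    refine Finset.sum_eq_zero fun j hj => ?_
    rw [Finset.mem_range] at hj
    rw [if_pos (by lia), hu.2 _ (by lia), zero_mul]

instance : Nontrivial (TwistedPoly Fq k) := by
  refine ⟨1, 0, fun h => ?_⟩
  have h1 := coeff_const_mul_tau_pow (Fq := Fq) (1 : k) 0 0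
  rw [map_one, pow_zero, mul_one, h, map_zero, if_pos rfl] at h1
  exact zero_ne_one h1

theorem tau_ne_zero : tau Fq k ≠ 0 := by
  intro h
  have h1 := coeff_const_mul_tau_pow (Fq := Fq) (1 : k) 1 1
  rw [pow_one, h, mul_zero, map_zero, if_pos rfl] at h1
  exact zero_ne_one h1

instance : NoZeroDivisors (TwistedPoly Fq k) where
  eq_zero_or_eq_zero_of_mul_eq_zero {u v} h := by
    by_contra! hne
    obtain ⟨n, c, hc, hu⟩ := exists_hasLeadingTerm hne.1
    obtain ⟨m, d, hd, hv⟩ := exists_hasLeadingTerm hne.2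
    exact (hu.mul hv).ne_zero (mul_ne_zero hc (pow_ne_zero _ hd)) h

theorem HasLeadingTerm.pow {u : TwistedPoly Fq k} {n : ℕ} {c : k} (hu : HasLeadingTerm u n c)
    (hc : c ≠ 0) (j : ℕ) : ∃ d, d ≠ 0 ∧ HasLeadingTerm (u ^ j) (n * j) d := by
  induction j with
  | zero =>
    refine ⟨1, one_ne_zero, ?_, fun i hi => ?_⟩
    · have := coeff_const_mul_tau_pow (Fq := Fq) (1 : k) 0 0
      simpa using this
    · have := coeff_const_mul_tau_pow (Fq := Fq) (1 : k) 0 i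
      rw [mul_zero] at hi
      simpa [hi.ne] using this
  | succ j ih =>
    obtain ⟨d, hd, h⟩ := ih
    exact ⟨_, mul_ne_zero hd (pow_ne_zero _ hc), h.mul hu⟩

theorem tau_pow_mul_const_mul_tau_pow_sub (c : k) {s : ℕ}
    (hs : s < Module.finrank Fq k) :
    tau Fq k ^ s * (const Fq k c * tau Fq k ^ (Module.finrank Fq k - s)) =
      const Fq k (c ^ Fintype.card Fq ^ s) * tau Fq k ^ Module.finrank Fq k := by
  rw [← mul_assoc, tau_pow_mul_const, mul_assoc, ← pow_add]
  congr 3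
  lia

/-! ### The action of `k[X]` -/

instance : Module k (TwistedPoly Fq k) := Module.compHom _ (const Fq k)

theorem smul_eq_const_mul (c : k) (u : TwistedPoly Fq k) : c • u = const Fq k c * u := rfl

/-- Right multiplication by `a`, a `k`-linear endomorphism. -/
def mulRight (a : TwistedPoly Fq k) : Module.End k (TwistedPoly Fq k) where
  toFun u := u * a
  map_add' u v := add_mul u v a
  map_smul' _ _ := mul_assoc _ _ _

theorem mulRight_apply (a u : TwistedPoly Fq k) : mulRight a u = u * a := rfl

theorem mulRight_pow_apply (a u : TwistedPoly Fq k) (n : ℕ) : (mulRight a ^ n) u = u * a ^ n := by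
  induction n with
  | zero => simp
  | succ n ih => rw [pow_succ', Module.End.mul_apply, ih, mulRight_apply, mul_assoc, ← pow_succ]

/-- The twisted polynomials, as a `k[X]`-module on which `X` acts as right multiplication by `a`. -/
def RightModule (a : TwistedPoly Fq k) : Type _ := Module.AEval' (mulRight a)

instance (a : TwistedPoly Fq k) : AddCommGroup (RightModule a) :=
  inferInstanceAs (AddCommGroup (Module.AEval' (mulRight a)))

instance (a : TwistedPoly Fq k) : Module k[X] (RightModule a) :=
  inferInstanceAs (Module k[X] (Module.AEval' (mulRight a)))

/-- The identity map onto `RightModule a`. -/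
def toRightModule (a : TwistedPoly Fq k) : TwistedPoly Fq k ≃+ RightModule a :=
  (Module.AEval'.of (mulRight a)).toAddEquiv

theorem smul_toRightModule (a : TwistedPoly Fq k) (p : k[X]) {N : ℕ} (hN : p.natDegree < N)
    (u : TwistedPoly Fq k) : p • toRightModule a u =
      toRightModule a (∑ j ∈ Finset.range N, const Fq k (p.coeff j) * u * a ^ j) := by
  have h : Polynomial.aeval (mulRight a) p u =
      ∑ j ∈ Finset.range N, const Fq k (p.coeff j) * u * a ^ j := by
    rw [Polynomial.aeval_eq_sum_range' hN, LinearMap.sum_apply]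
    refine Finset.sum_congr rfl fun j _ => ?_
    rw [LinearMap.smul_apply, mulRight_pow_apply, smul_eq_const_mul, mul_assoc]
  exact congrArg (toRightModule a) h

variable {a : TwistedPoly Fq k} {r : ℕ} {c : k}

theorem X_smul_toRightModule (a u : TwistedPoly Fq k) :
    (Polynomial.X : k[X]) • toRightModule a u = toRightModule a (u * a) :=
  Module.AEval'.X_smul_of (mulRight a) u

theorem C_smul_toRightModule (a u : TwistedPoly Fq k) (c : k) :
    Polynomial.C c • toRightModule a u = toRightModule a (const Fq k c * u) := by
  rw [smul_toRightModule a (Polynomial.C c) (N := 1) (by simp) u]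
  simp

/-- For `u` of degree `n`, the terms of `p • u` have the distinct degrees `n + r * j`, as `r ≥ 1`,
so the top one cannot cancel. -/
theorem isTorsionFree_rightModule (ha : HasLeadingTerm a r c) (hc : c ≠ 0) (hr : 1 ≤ r) :
    Module.IsTorsionFree k[X] (RightModule a) := by
  refine Module.IsTorsionFree.of_smul_eq_zero fun p x h => ?_
  by_contra! hne
  obtain ⟨u, rfl⟩ := (toRightModule a).surjective x
  have hu : u ≠ 0 := fun h0 => hne.2 (by rw [h0, map_zero])
  obtain ⟨n, d, hd, hun⟩ := exists_hasLeadingTerm hu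
  rw [smul_toRightModule a p (Nat.lt_succ_self _), AddEquivClass.map_eq_zero_iff] at h
  have h1 := congrArg (coeff (n + r * p.natDegree)) h
  rw [map_zero, map_sum, Finset.sum_eq_single p.natDegree] at h1
  · obtain ⟨e, he, hlead⟩ := ha.pow hc p.natDegree
    rw [mul_assoc, coeff_const_mul, (hun.mul hlead).1] at h1
    exact mul_ne_zero (Polynomial.leadingCoeff_ne_zero.2 hne.1)
      (mul_ne_zero hd (pow_ne_zero _ he)) h1
  · intro j hj hjp
    have hj : j < p.natDegree := by
      have := Finset.mem_range.1 hj
      lia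
    obtain ⟨e, he, hlead⟩ := ha.pow hc j
    rw [mul_assoc, coeff_const_mul, (hun.mul hlead).2 _ (by gcongr), mul_zero]
  · simp

/-- Division with remainder: the span contains an element of each degree `m`, namely `τ ^ m` for `m
< r` and otherwise `τ ^ (m - r) * a`, which is `X` times an element of lower degree. Subtracting a
constant multiple of it lowers the degree. -/
theorem span_rightModule (ha : HasLeadingTerm a r c) (hc : c ≠ 0) (hr : 1 ≤ r) :
    Submodule.span k[X] (Set.range fun i : Fin r => toRightModule a (tau Fq k ^ (i : ℕ))) = ⊤ := by
  set S := Submodule.span k[X] (Set.range fun i : Fin r => toRightModule a (tau Fq k ^ (i : ℕ)))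
  have key (m : ℕ) : ∀ u : TwistedPoly Fq k, (∀ i, m ≤ i → coeff i u = 0) →
      toRightModule a u ∈ S := by
    induction m with
    | zero =>
      intro u hu
      rw [eq_sum_of_coeff_eq_zero hu, Finset.range_zero, Finset.sum_empty, map_zero]
      exact zero_mem S
    | succ m ih =>
      intro u hu
      obtain ⟨v, d, hd, hv, hmem⟩ : ∃ (v : TwistedPoly Fq k) (d : k), d ≠ 0 ∧
          HasLeadingTerm v m d ∧ toRightModule a v ∈ S := by
        have htau (j : ℕ) : HasLeadingTerm (tau Fq k ^ j) j 1 := by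
          have h (n : ℕ) := coeff_const_mul_tau_pow (Fq := Fq) (1 : k) j n
          simp only [map_one, one_mul] at h
          exact ⟨(h j).trans (if_pos rfl), fun i hi => (h i).trans (if_neg hi.ne)⟩
        by_cases hm : m < r
        · exact ⟨_, 1, one_ne_zero, htau m, Submodule.subset_span ⟨⟨m, hm⟩, rfl⟩⟩
        · have hlead := (htau (m - r)).mul ha
          rw [Nat.sub_add_cancel (not_lt.1 hm)] at hlead
          refine ⟨_, _, mul_ne_zero one_ne_zero (pow_ne_zero _ hc), hlead, ?_⟩
          rw [← X_smul_toRightModule]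
          refine S.smul_mem _ (ih _ fun i hi => (htau (m - r)).2 i (by lia))
      have h := ih (u - const Fq k (coeff m u / d) * v) fun i hi => by
        rw [map_sub, coeff_const_mul]
        rcases hi.eq_or_lt with rfl | hi
        · rw [hv.1, div_mul_cancel₀ _ hd, sub_self]
        · rw [hv.2 i hi, hu i hi, mul_zero, sub_zero]
      rw [map_sub, ← C_smul_toRightModule] at h
      simpa using add_mem h (S.smul_mem (Polynomial.C (coeff m u / d)) hmem)
  rw [eq_top_iff]
  rintro x -
  obtain ⟨u, rfl⟩ := (toRightModule a).surjective x
  obtain ⟨N, hN⟩ := exists_coeff_eq_zero u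
  exact key N u hN

end TwistedPoly

/-! ### The endomorphism ring of a Drinfeld module -/

theorem Polynomial.finite_mapRingHom {R S : Type*} [CommRing R] [CommRing S] [Algebra R S]
    [Module.Finite R S] : (Polynomial.mapRingHom (algebraMap R S)).Finite := by
  let f := Polynomial.mapRingHom (algebraMap R S)
  let : Algebra R[X] S[X] := f.toAlgebra
  obtain ⟨s, hs⟩ := Module.Finite.fg_top (R := R) (M := S)
  classical
  refine ⟨⟨s.image Polynomial.C, ?_⟩⟩
  rw [eq_top_iff]
  rintro p -
  induction p using Polynomial.induction_on' with
  | add p q hp hq => exact add_mem hp hq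
  | monomial n c =>
    have hc : c ∈ Submodule.span R (s : Set S) := hs ▸ Submodule.mem_top
    induction hc using Submodule.span_induction with
    | mem c hc =>
      have : Polynomial.monomial n c = (Polynomial.X ^ n : R[X]) • (Polynomial.C c : S[X]) := by
        rw [Algebra.smul_def, ← Polynomial.C_mul_X_pow_eq_monomial, mul_comm]
        congr 1
        exact (Polynomial.map_pow (algebraMap R S) n).trans (by rw [Polynomial.map_X]) |>.symm
      rw [this]
      exact Submodule.smul_mem _ _
        (Submodule.subset_span (Finset.mem_coe.2 (Finset.mem_image_of_mem _ hc)))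
    | zero => rw [Polynomial.monomial_zero_right]; exact zero_mem _
    | add c d _ _ hc hd => rw [map_add]; exact add_mem hc hd
    | smul x c _ hc =>
      have : Polynomial.monomial n (x • c) = (Polynomial.C x : R[X]) • Polynomial.monomial n c := by
        rw [Algebra.smul_def, Algebra.smul_def, ← Polynomial.C_mul_monomial]
        congr 1
        exact (Polynomial.map_C (algebraMap R S)).symm
      rw [this]
      exact Submodule.smul_mem _ _ hc

theorem Module.Finite.compHom {R S M : Type*} [CommRing R] [CommRing S] [AddCommGroup M]
    [Module S M] [Module.Finite S M] {f : R →+* S} (hf : f.Finite) :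
    letI : Module R M := Module.compHom M f
    Module.Finite R M := by
  let : Algebra R S := f.toAlgebra
  let : Module R M := Module.compHom M f
  have : IsScalarTower R S M := ⟨fun p q x => by rw [Algebra.smul_def, mul_smul]; rfl⟩
  have : Module.Finite R S := hf
  exact Module.Finite.trans S M

namespace DrinfeldModule

open TwistedPoly

variable {Fq k : Type*} [Field Fq] [Fintype Fq] [Field k] [Algebra Fq k] [Algebra Fq[X] k] {r : ℕ}
  (φ : DrinfeldModule Fq k r)

theorem exists_hasLeadingTerm_toRingHom_X :
    ∃ c, c ≠ 0 ∧ HasLeadingTerm (φ.toRingHom Polynomial.X) r c := by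
  obtain ⟨g, hg, h⟩ := φ.map_X
  have hcoeff (n : ℕ) (hn : 1 ≤ n) : coeff n (φ.toRingHom Polynomial.X) =
      if n ≤ r then g n else 0 := by
    have h0 := coeff_const_mul_tau_pow (Fq := Fq) (algebraMap Fq[X] k Polynomial.X) 0 n
    rw [pow_zero, mul_one, if_neg (by lia)] at h0
    rw [h, map_add, h0, zero_add, map_sum]
    simp only [coeff_const_mul_tau_pow, Finset.sum_ite_eq', Finset.mem_Icc, hn, true_and]
  refine ⟨g r, hg, ?_, fun i hi => ?_⟩
  · rw [hcoeff r φ.rank_pos, if_pos le_rfl]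
  · rw [hcoeff i (by lia), if_neg (by lia)]

theorem toRingHom_eq_sum (p : Fq[X]) {N : ℕ} (hN : p.natDegree < N) :
    φ.toRingHom p = ∑ j ∈ Finset.range N,
      const Fq k (algebraMap Fq k (p.coeff j)) * φ.toRingHom Polynomial.X ^ j := by
  conv_lhs => rw [p.as_sum_range' N hN, map_sum]
  refine Finset.sum_congr rfl fun j _ => ?_
  rw [← Polynomial.C_mul_X_pow_eq_monomial, map_mul, map_pow, φ.map_C]

theorem commute_toRingHom (e : φ.EndRing) (p : Fq[X]) :
    Commute (φ.toRingHom p) (e : TwistedPoly Fq k) :=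
  e.2 _ ⟨p, rfl⟩

theorem coe_smul (p : Fq[X]) (e : φ.EndRing) :
    ((p • e : φ.EndRing) : TwistedPoly Fq k) = φ.toRingHom p * e := rfl

/-- Right multiplication by an endomorphism of `φ`. -/
def endMul (e : φ.EndRing) : Module.End k[X] (RightModule (φ.toRingHom Polynomial.X)) where
  toFun x := toRightModule _ ((toRightModule _).symm x * e)
  map_add' x y := by rw [map_add, add_mul, map_add]
  map_smul' p x := by
    obtain ⟨u, rfl⟩ := (toRightModule _).surjective x
    rw [smul_toRightModule _ p (Nat.lt_succ_self _), AddEquiv.symm_apply_apply,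
      AddEquiv.symm_apply_apply, RingHom.id_apply, smul_toRightModule _ p (Nat.lt_succ_self _),
      Finset.sum_mul]
    congr 1
    refine Finset.sum_congr rfl fun j _ => ?_
    rw [mul_assoc, ((φ.commute_toRingHom e Polynomial.X).pow_left j).eq, ← mul_assoc, ← mul_assoc]

theorem endMul_toRightModule (e : φ.EndRing) (u : TwistedPoly Fq k) :
    φ.endMul e (toRightModule _ u) = toRightModule _ (u * (e : TwistedPoly Fq k)) := by
  change toRightModule _ ((toRightModule _).symm (toRightModule _ u) * (e : TwistedPoly Fq k)) = _
  rw [AddEquiv.symm_apply_apply]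

theorem endMul_ext {f g : Module.End k[X] (RightModule (φ.toRingHom Polynomial.X))}
    (h : ∀ u, f (toRightModule _ u) = g (toRightModule _ u)) : f = g := by
  ext x
  obtain ⟨u, rfl⟩ := (toRightModule _).surjective x
  exact h u

theorem endMul_mul (e e' : φ.EndRing) : φ.endMul (e * e') = φ.endMul e' * φ.endMul e := by
  apply φ.endMul_ext
  intro u
  rw [Module.End.mul_apply, endMul_toRightModule, endMul_toRightModule, endMul_toRightModule,
    mul_assoc]
  rfl

theorem endMul_pow (e : φ.EndRing) (n : ℕ) : φ.endMul (e ^ n) = φ.endMul e ^ n := by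
  induction n with
  | zero =>
    apply φ.endMul_ext
    intro u
    rw [pow_zero, pow_zero, endMul_toRightModule]
    exact congrArg _ (mul_one u)
  | succ n ih => rw [pow_succ, endMul_mul, ih, pow_succ']

theorem endMul_injective : Function.Injective φ.endMul := by
  intro e e' h
  have := LinearMap.congr_fun h (toRightModule _ 1)
  rw [endMul_toRightModule, endMul_toRightModule, one_mul, one_mul] at this
  exact Subtype.ext ((toRightModule _).injective this)

section Finite

variable [Finite k]

/-- A relation with coefficients in `k[X]` is turned into relations over `A` by taking traces to
`Fq` of its coefficients multiplied by an arbitrary `d : k`. These are trivial, and nondegeneracy of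
the trace form makes the original one trivial. -/
theorem linearIndependent_endMul {ι : Type*} [Fintype ι] {e : ι → φ.EndRing}
    (h : LinearIndependent Fq[X] e) : LinearIndependent k[X] fun i => φ.endMul (e i) := by
  set a := φ.toRingHom Polynomial.X
  set n := Module.finrank Fq k with hn
  rw [Fintype.linearIndependent_iff] at h ⊢
  intro c hc
  let N := Finset.univ.sup (fun i => (c i).natDegree) + 1
  have hN (i : ι) : (c i).natDegree < N :=
    Nat.lt_succ_of_le (Finset.le_sup (f := fun i => (c i).natDegree) (Finset.mem_univ i))
  have hrel (u : TwistedPoly Fq k) :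
      ∑ i, ∑ j ∈ Finset.range N, const Fq k ((c i).coeff j) * u * (a ^ j * e i) = 0 := by
    have h1 := LinearMap.congr_fun hc (toRightModule a u)
    rw [LinearMap.sum_apply, LinearMap.zero_apply] at h1
    simp only [LinearMap.smul_apply] at h1
    apply (toRightModule a).injective
    rw [map_zero, ← h1, map_sum]
    refine Finset.sum_congr rfl fun i _ => ?_
    rw [← LinearMap.map_smul, smul_toRightModule a (c i) (hN i), endMul_toRightModule,
      Finset.sum_mul]
    simp only [mul_assoc]
    rfl
  have htrace (d : k) (i : ι) (j : ℕ) (hj : j < N) :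
      Algebra.trace Fq k (d * (c i).coeff j) = 0 := by
    let g (i : ι) : Fq[X] := ∑ j ∈ Finset.range N,
      Polynomial.monomial j (Algebra.trace Fq k (d * (c i).coeff j))
    have hg : ∑ i, g i • e i = 0 := by
      apply Subtype.ext
      have hcoe : ((∑ i, g i • e i : φ.EndRing) : TwistedPoly Fq k) =
          ∑ i, ∑ j ∈ Finset.range N, const Fq k (algebraMap Fq k
            (Algebra.trace Fq k (d * (c i).coeff j))) * (a ^ j * e i) := by
        rw [AddSubmonoidClass.coe_finsetSum]
        refine Finset.sum_congr rfl fun i _ => ?_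
        rw [coe_smul, map_sum, Finset.sum_mul]
        refine Finset.sum_congr rfl fun j _ => ?_
        rw [← Polynomial.C_mul_X_pow_eq_monomial, map_mul, map_pow, φ.map_C, mul_assoc]
      -- The trace of `x` is the sum of `x ^ (q ^ s)` for `s < n`, and `τ ^ s * x * τ ^ (n - s) = x
      -- ^ (q ^ s) * τ ^ n`. So `τ ^ n` times the traced relation is a combination of the relations
      -- `hrel` at `u = τ ^ (n - s)`, all of which vanish.
      have hzero : tau Fq k ^ n * ((∑ i, g i • e i : φ.EndRing) : TwistedPoly Fq k) =
          ∑ s ∈ Finset.range n, const Fq k (d ^ Fintype.card Fq ^ s) * (tau Fq k ^ s *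
            ∑ i, ∑ j ∈ Finset.range N,
              const Fq k ((c i).coeff j) * tau Fq k ^ (n - s) * (a ^ j * e i)) := by
        simp only [hcoe, Finset.mul_sum]
        symm
        rw [Finset.sum_comm]
        refine Finset.sum_congr rfl fun i _ => ?_
        rw [Finset.sum_comm]
        refine Finset.sum_congr rfl fun j _ => ?_
        symm
        rw [FiniteField.algebraMap_trace_eq_sum_pow, map_sum, Finset.sum_mul, Finset.mul_sum]
        refine Finset.sum_congr rfl fun s hs => ?_
        rw [← mul_assoc, tau_pow_finrank_comm, ← mul_assoc (tau Fq k ^ s),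
          tau_pow_mul_const_mul_tau_pow_sub _ (Finset.mem_range.1 hs), mul_pow, map_mul,
          Nat.card_eq_fintype_card]
        simp only [mul_assoc]
      simp only [hrel, mul_zero, Finset.sum_const_zero] at hzero
      exact (mul_eq_zero.1 hzero).resolve_left (pow_ne_zero _ tau_ne_zero)
    have := congrArg (fun p => Polynomial.coeff p j) (h g hg i)
    simpa [g, Polynomial.coeff_monomial, hj] using this
  intro i
  ext j
  by_cases hj : j < N
  · rw [Polynomial.coeff_zero]
    apply (traceForm_nondegenerate Fq k).1 ((c i).coeff j)
    intro d
    rw [Algebra.traceForm_apply, mul_comm]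
    exact htrace d i j hj
  · rw [Polynomial.coeff_eq_zero_of_natDegree_lt ((hN i).trans_le (not_lt.1 hj)),
      Polynomial.coeff_zero]

instance finite_endRing : Module.Finite Fq[X] φ.EndRing := by
  set a := φ.toRingHom Polynomial.X
  obtain ⟨c, hc, ha⟩ := φ.exists_hasLeadingTerm_toRingHom_X
  let f := Polynomial.mapRingHom (algebraMap Fq k)
  have hf : f.Finite := Polynomial.finite_mapRingHom
  let : Module Fq[X] (RightModule a) := Module.compHom _ f
  have : Module.Finite k[X] (RightModule a) :=
    ⟨Submodule.fg_def.2 ⟨_, Set.finite_range _, span_rightModule ha hc φ.rank_pos⟩⟩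
  have : Module.Finite Fq[X] (RightModule a) := Module.Finite.compHom hf
  -- On `ℰ`, left multiplication by `φ_p` agrees with the action of `p` through right multiplication
  -- by `φ_T`, so the inclusion into the finite module is `A`-linear.
  let g : φ.EndRing →ₗ[Fq[X]] RightModule a :=
    { toFun := fun e => toRightModule a e
      map_add' := fun e e' => map_add _ _ _
      map_smul' := fun p e => by
        change _ = f p • toRightModule a e
        rw [smul_toRightModule a (f p) (N := p.natDegree + 1)
          (Nat.lt_succ_of_le (Polynomial.natDegree_map_le)), coe_smul,
          φ.toRingHom_eq_sum p (Nat.lt_succ_self _), Finset.sum_mul]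
        congr 1
        refine Finset.sum_congr rfl fun j _ => ?_
        rw [mul_assoc, mul_assoc, ((φ.commute_toRingHom e Polynomial.X).pow_left j).eq]
        congr 2
        exact (Polynomial.coeff_map _ _).symm }
  exact Module.Finite.of_injective g fun e e' h => Subtype.ext ((toRightModule a).injective h)

end Finite

end DrinfeldModule

/-! ### Dimension of the algebra generated by one element -/

theorem finrank_adjoin_singleton_le_natDegree {F D : Type*} [Field F] [Ring D] [Algebra F D] {x : D}
    {p : F[X]} (hp : p ≠ 0) (hx : Polynomial.aeval x p = 0) :
    Module.finrank F (Algebra.adjoin F {x}) ≤ p.natDegree := by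
  have hrange : Subalgebra.toSubmodule (Algebra.adjoin F {x}) =
      Submodule.span F (Set.range fun i : Fin p.natDegree => x ^ (i : ℕ)) := by
    apply le_antisymm
    · intro y hy
      rw [Subalgebra.mem_toSubmodule, Algebra.adjoin_singleton_eq_range_aeval] at hy
      obtain ⟨f, rfl⟩ := hy
      have hf : Polynomial.aeval x f = Polynomial.aeval x (f % p) := by
        conv_lhs => rw [← EuclideanDomain.div_add_mod f p]
        rw [map_add, map_mul, hx, zero_mul, zero_add]
      change Polynomial.aeval x f ∈ _
      by_cases h0 : f % p = 0
      · rw [hf, h0, map_zero]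
        exact zero_mem _
      rw [hf, Polynomial.aeval_eq_sum_range' (Polynomial.natDegree_lt_natDegree h0
        (EuclideanDomain.mod_lt f hp))]
      exact sum_mem fun i hi => Submodule.smul_mem _ _
        (Submodule.subset_span ⟨⟨i, Finset.mem_range.1 hi⟩, rfl⟩)
    · rw [Submodule.span_le]
      rintro _ ⟨i, rfl⟩
      exact pow_mem (Algebra.self_mem_adjoin_singleton F x) _
  change Module.finrank F (Subalgebra.toSubmodule (Algebra.adjoin F {x})) ≤ _
  rw [hrange]
  exact (finrank_range_le_card _).trans (by simp)

theorem linearIndependent_pow_of_finrank_adjoin {F D : Type*} [Field F] [Ring D] [Algebra F D]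
    {x : D} {r : ℕ} (hr : r ≤ Module.finrank F (Algebra.adjoin F {x})) :
    LinearIndependent F fun i : Fin r => x ^ (i : ℕ) := by
  rw [Fintype.linearIndependent_iff]
  intro c hc
  let p : F[X] := ∑ i : Fin r, Polynomial.monomial (i : ℕ) (c i)
  have hpx : Polynomial.aeval x p = 0 := by
    rw [← hc]
    simp [p, Polynomial.aeval_monomial, Algebra.smul_def]
  have hcoeff (i : Fin r) : p.coeff i = c i := by
    simp only [p, Polynomial.finsetSum_coeff, Polynomial.coeff_monomial, Fin.val_inj]
    simp
  by_cases hp : p = 0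
  · intro i
    rw [← hcoeff, hp, Polynomial.coeff_zero]
  · have h1 := hr.trans (finrank_adjoin_singleton_le_natDegree hp hpx)
    refine absurd (Polynomial.leadingCoeff_eq_zero.1 ?_) hp
    rw [Polynomial.leadingCoeff, Polynomial.finsetSum_coeff]
    refine Finset.sum_eq_zero fun i _ => ?_
    rw [Polynomial.coeff_monomial, if_neg (i.2.trans_le h1).ne]

/-! ### Commutativity and rank of the endomorphism ring -/

namespace DrinfeldModule

open TwistedPoly

variable {Fq k : Type*} [Field Fq] [Fintype Fq] [Field k] [Algebra Fq k] [Algebra Fq[X] k] {r : ℕ}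
  (φ : DrinfeldModule Fq k r)

instance isTorsionFree_endRing : Module.IsTorsionFree Fq[X] φ.EndRing := by
  refine Module.IsTorsionFree.of_smul_eq_zero fun p e h => ?_
  have h1 : φ.toRingHom p * (e : TwistedPoly Fq k) = 0 := congrArg Subtype.val h
  rcases mul_eq_zero.1 h1 with h1 | h1
  · left
    obtain ⟨c, hc, ha⟩ := φ.exists_hasLeadingTerm_toRingHom_X
    have := isTorsionFree_rightModule ha hc φ.rank_pos
    -- `φ_p` is `p` acting on `1`, so `φ_p = 0` forces `p = 0` by torsion-freeness.
    have h2 : p.map (algebraMap Fq k) • toRightModule (φ.toRingHom Polynomial.X) 1 = 0 := by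
      rw [smul_toRightModule _ _ (N := p.natDegree + 1)
        (Nat.lt_succ_of_le Polynomial.natDegree_map_le), ← map_zero (toRightModule _), ← h1,
        φ.toRingHom_eq_sum p (Nat.lt_succ_self _)]
      simp only [mul_one, Polynomial.coeff_map]
    rcases smul_eq_zero.1 h2 with h2 | h2
    · exact (Polynomial.map_eq_zero _).1 h2
    · exact absurd ((toRightModule _).map_eq_zero_iff.1 h2) one_ne_zero
  · exact Or.inr (Subtype.ext h1)

variable [Finite k] (hK : Module.finrank (RatFunc Fq) φ.frobField = r)
include hK

theorem linearIndependent_frob_pow : LinearIndependent Fq[X] fun i : Fin r => φ.frob ^ (i : ℕ) := by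
  have h1 : LinearIndependent (RatFunc Fq)
      fun i : Fin r => ((1 : RatFunc Fq) ⊗ₜ[Fq[X]] φ.frob : φ.EndAlg) ^ (i : ℕ) :=
    linearIndependent_pow_of_finrank_adjoin hK.ge
  have h2 : LinearIndependent Fq[X]
      fun i : Fin r => ((1 : RatFunc Fq) ⊗ₜ[Fq[X]] φ.frob : φ.EndAlg) ^ (i : ℕ) :=
    h1.restrict_scalars (by
      intro p q h
      simp only [Algebra.smul_def, mul_one] at h
      exact IsFractionRing.injective Fq[X] (RatFunc Fq) h)
  apply LinearIndependent.of_comp (TensorProduct.mk Fq[X] (RatFunc Fq) φ.EndRing 1)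
  have h3 : (TensorProduct.mk Fq[X] (RatFunc Fq) φ.EndRing 1 ∘ fun i : Fin r => φ.frob ^ (i : ℕ)) =
      fun i : Fin r => ((1 : RatFunc Fq) ⊗ₜ[Fq[X]] φ.frob : φ.EndAlg) ^ (i : ℕ) := by
    funext i
    rw [Algebra.TensorProduct.tmul_pow, one_pow]
    rfl
  rw [h3]
  exact h2

theorem linearIndependent_endMul_frob_pow :
    LinearIndependent k[X] fun i : Fin r => φ.endMul φ.frob ^ (i : ℕ) := by
  simpa only [endMul_pow] using φ.linearIndependent_endMul (φ.linearIndependent_frob_pow hK)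

omit hK in
theorem commute_endMul_frob (e : φ.EndRing) : Commute (φ.endMul φ.frob) (φ.endMul e) := by
  have h : φ.frob * e = e * φ.frob := Subtype.ext (tau_pow_finrank_comm Fq k e)
  rw [Commute, SemiconjBy, ← endMul_mul, ← endMul_mul, h]

theorem endRing_mul_comm (e e' : φ.EndRing) : e * e' = e' * e := by
  obtain ⟨c, hc, ha⟩ := φ.exists_hasLeadingTerm_toRingHom_X
  have := isTorsionFree_rightModule ha hc φ.rank_pos
  apply φ.endMul_injective
  rw [endMul_mul, endMul_mul]
  exact Module.End.commute_of_commute_of_linearIndependent_pow (span_rightModule ha hc φ.rank_pos)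
    (φ.linearIndependent_endMul_frob_pow hK) (φ.commute_endMul_frob e') (φ.commute_endMul_frob e)

theorem finrank_endRing_le : Module.finrank Fq[X] φ.EndRing ≤ r := by
  obtain ⟨c, hc, ha⟩ := φ.exists_hasLeadingTerm_toRingHom_X
  have := isTorsionFree_rightModule ha hc φ.rank_pos
  have h := Module.End.card_le_of_commute_of_linearIndependent_pow
    (span_rightModule ha hc φ.rank_pos) (φ.linearIndependent_endMul_frob_pow hK)
    (fun i => φ.commute_endMul_frob _)
    (φ.linearIndependent_endMul (Module.finBasis Fq[X] φ.EndRing).linearIndependent)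
  rwa [Fintype.card_fin] at h

theorem frobField_eq_top : φ.frobField = ⊤ := by
  apply Algebra.toSubmodule_eq_top.1
  have : Module.Finite (RatFunc Fq) φ.EndAlg := Module.Finite.base_change _ _ _
  apply Submodule.eq_top_of_finrank_eq
  apply le_antisymm (Submodule.finrank_le _)
  rw [Module.finrank_baseChange]
  exact (φ.finrank_endRing_le hK).trans hK.ge

end DrinfeldModule

/-! ### Gorenstein completions of orders -/

section Order

variable {A E : Type*} [CommRing A] [IsDomain A] [IsPrincipalIdealRing A]

theorem isPrincipalIdealRing_quotient_map_of_tensor_isIntegral [CommRing E] [Algebra A E]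
    [IsDomain E] [Module.Finite A E] [Module.IsTorsionFree A E] (F : Type*) [Field F] [Algebra A F]
    [IsFractionRing A F] (l : Ideal A) [l.IsMaximal]
    (h : ∀ x : F ⊗[A] E, IsIntegral A x → ∃ s ∉ l, ∃ e : E, s • x = 1 ⊗ₜ e) :
    IsPrincipalIdealRing (E ⧸ l.map (algebraMap A E)) := by
  have hinj : Function.Injective (algebraMap A E) := FaithfulSMul.algebraMap_injective A E
  apply isPrincipalIdealRing_quotient_map_of_integrallyClosed l
  rintro a e ha ⟨p, hp, hpe⟩
  have ha' : algebraMap A F a ≠ 0 := by simpa using ha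
  have hfe : Function.Injective fun e : E => (1 : F) ⊗ₜ[A] e :=
    Algebra.TensorProduct.includeRight_injective (IsFractionRing.injective A F)
  -- Integrality has to pass from `e/a` in the fraction field of `E` to `a⁻¹ ⊗ e` in `F ⊗ E`.
  -- Scaling the roots of `p` by `a` gives an equation for `e` in `E`, which maps into both rings.
  have hscale : Polynomial.aeval e (p.scaleRoots a) = 0 := by
    apply IsFractionRing.injective E (FractionRing E)
    have h1 : algebraMap A (FractionRing E) a ≠ 0 := by
      rw [IsScalarTower.algebraMap_apply A E]
      simpa using ha
    rw [← IsScalarTower.algebraMap_apply A E] at hpe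
    have h2 := Polynomial.scaleRoots_aeval_eq_zero (r := a) hpe
    rw [mul_div_cancel₀ _ h1, Polynomial.aeval_algebraMap_apply] at h2
    rw [h2, map_zero]
  have hint : IsIntegral A ((algebraMap A F a)⁻¹ ⊗ₜ[A] e) := by
    refine ⟨p, hp, ?_⟩
    have h1 := Polynomial.scaleRoots_eval₂_mul (p := p) (algebraMap A (F ⊗[A] E))
      ((algebraMap A F a)⁻¹ ⊗ₜ[A] e) a
    have h2 : algebraMap A (F ⊗[A] E) a * (algebraMap A F a)⁻¹ ⊗ₜ[A] e = 1 ⊗ₜ e := by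
      rw [← Algebra.smul_def, TensorProduct.smul_tmul', Algebra.smul_def, mul_inv_cancel₀ ha']
    have h3 : Polynomial.eval₂ (algebraMap A (F ⊗[A] E)) (1 ⊗ₜ e) (p.scaleRoots a) = 0 := by
      have := congrArg (Algebra.TensorProduct.includeRight : E →ₐ[A] F ⊗[A] E) hscale
      rwa [map_zero, ← Polynomial.aeval_algHom_apply] at this
    rw [h2, h3] at h1
    have hu : IsUnit (algebraMap A (F ⊗[A] E) a) := by
      rw [IsScalarTower.algebraMap_apply A F]
      exact (IsUnit.mk0 _ ha').map _
    exact (hu.pow _).mul_right_eq_zero.1 h1.symm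
  obtain ⟨s, hs, e', he'⟩ := h _ hint
  refine ⟨s, hs, e', hfe ?_⟩
  have := congrArg (a • ·) he'
  simp only [TensorProduct.smul_tmul'] at this
  rw [smul_comm, Algebra.smul_def a, mul_inv_cancel₀ ha', TensorProduct.smul_tmul,
    TensorProduct.smul_tmul] at this
  exact this

variable [inst : Ring E] [Algebra A E] [Module.Finite A E] [Module.IsTorsionFree A E]
  (hc : ∀ x y : E, x * y = y * x) (l : Ideal A) [l.IsMaximal]
include hc

theorem isGorensteinAlgebra_completion_of_adjoin_eq_top' (x : AdicCompletion l A ⊗[A] E)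
    (h : Algebra.adjoin (AdicCompletion l A) {x} = ⊤) :
    IsGorensteinAlgebra (l.map (algebraMap A (AdicCompletion l A)))
      (AdicCompletion l A ⊗[A] E) := by
  -- The given ring structure is replaced by that of a commutative ring, so the algebra structures
  -- built on it remain the same.
  obtain ⟨inst', rfl⟩ : ∃ c : CommRing E, c.toRing = inst := ⟨{ inst with mul_comm := hc }, rfl⟩
  exact isGorensteinAlgebra_completion_of_adjoin_eq_top l x h

theorem isGorensteinAlgebra_completion_of_finrank_le_two (h : Module.finrank A E ≤ 2) :
    IsGorensteinAlgebra (l.map (algebraMap A (AdicCompletion l A)))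
      (AdicCompletion l A ⊗[A] E) := by
  obtain ⟨inst', rfl⟩ : ∃ c : CommRing E, c.toRing = inst := ⟨{ inst with mul_comm := hc }, rfl⟩
  exact isGorensteinAlgebra_completion_of_quotient l
    (isPrincipalIdealRing_quotient_map_of_card_le_two l ((Fintype.card_fin _).trans_le h)
      (Module.finBasis A E) (Module.finBasis A E).span_eq)

theorem isGorensteinAlgebra_completion_of_isIntegral [IsDomain E] (F : Type*) [Field F]
    [Algebra A F] [IsFractionRing A F]
    (h : ∀ x : F ⊗[A] E, IsIntegral A x → ∃ s ∉ l, ∃ e : E, s • x = 1 ⊗ₜ e) :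
    IsGorensteinAlgebra (l.map (algebraMap A (AdicCompletion l A)))
      (AdicCompletion l A ⊗[A] E) := by
  obtain ⟨inst', rfl⟩ : ∃ c : CommRing E, c.toRing = inst := ⟨{ inst with mul_comm := hc }, rfl⟩
  exact isGorensteinAlgebra_completion_of_quotient l
    (isPrincipalIdealRing_quotient_map_of_tensor_isIntegral F l h)

end Order

theorem exists_notMem_smul_eq_zero_of_not_dvd_moduleIndex {A M : Type*} [CommRing A] [IsDomain A]
    [IsPrincipalIdealRing A] [AddCommGroup M] [Module A M] {l : Ideal A}
    (h : ¬ l ∣ moduleIndex A M) : ∃ c ∉ l, ∀ m : M, c • m = 0 := by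
  rw [Ideal.dvd_iff_le, moduleIndex, Ideal.span_le, Set.not_subset] at h
  obtain ⟨c, ⟨n, b, -, -, ⟨f⟩, rfl⟩, hc⟩ := h
  refine ⟨_, hc, fun m => f.injective ?_⟩
  rw [map_smul, map_zero]
  ext i
  rw [Pi.smul_apply, Pi.zero_apply]
  obtain ⟨x, hx⟩ := Ideal.Quotient.mk_surjective (f m i)
  rw [← hx]
  refine Ideal.Quotient.eq_zero_iff_mem.2 (Ideal.mul_mem_right _ _ ?_)
  exact Ideal.mem_span_singleton.2 (Finset.dvd_prod_of_mem b (Finset.mem_univ i))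

theorem adjoin_one_tmul_eq_top_of_smul_mem {A E : Type*} [CommRing A] [IsNoetherianRing A] [Ring E]
    [Algebra A E] (l : Ideal A) [l.IsMaximal] {x : E} {c : A} (hc : c ∉ l)
    (h : ∀ e : E, c • e ∈ Algebra.adjoin A {x}) :
    Algebra.adjoin (AdicCompletion l A) {(1 ⊗ₜ[A] x : AdicCompletion l A ⊗[A] E)} = ⊤ := by
  set S := Algebra.adjoin (AdicCompletion l A) {(1 ⊗ₜ[A] x : AdicCompletion l A ⊗[A] E)}
  have hle : Algebra.adjoin A {x} ≤ (S.restrictScalars A).comap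
      (Algebra.TensorProduct.includeRight : E →ₐ[A] AdicCompletion l A ⊗[A] E) := by
    rw [Algebra.adjoin_le_iff, Set.singleton_subset_iff]
    exact Algebra.self_mem_adjoin_singleton _ _
  obtain ⟨u, hu⟩ := (AdicCompletion.isUnit_algebraMap_of_notMem l hc).exists_left_inv
  rw [eq_top_iff]
  rintro y -
  induction y using TensorProduct.induction_on with
  | zero => exact zero_mem S
  | add y z hy hz => exact add_mem hy hz
  | tmul t e =>
    -- Since `c ∉ l` is a unit in the completion, with inverse `u`, the denominator `c` can be
    -- cleared.
    have h1 : t ⊗ₜ[A] e = (t * u) • ((1 : AdicCompletion l A) ⊗ₜ[A] (c • e)) := by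
      rw [← TensorProduct.smul_tmul, TensorProduct.smul_tmul', Algebra.smul_def c, mul_one,
        smul_eq_mul, mul_assoc, hu, mul_one]
    rw [h1]
    exact S.smul_mem (hle (h e)) _

namespace DrinfeldModule

variable {Fq k : Type*} [Field Fq] [Fintype Fq] [Field k] [Algebra Fq k] [Algebra Fq[X] k] {r : ℕ}
  (φ : DrinfeldModule Fq k r)

theorem isGorensteinAlgebra_endCompletion_of_maxLattice [Finite k]
    (hK : Module.finrank (RatFunc Fq) φ.frobField = r) (l : Ideal Fq[X]) [l.IsMaximal]
    (h : ∀ x ∈ φ.maxLattice, ∃ s ∉ l, s • x ∈ φ.endLattice) :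
    IsGorensteinAlgebra (l.map (algebraMap Fq[X] (AdicCompletion l Fq[X])))
      (φ.EndCompletion l) := by
  have : IsDomain φ.EndRing := NoZeroDivisors.to_isDomain _
  refine isGorensteinAlgebra_completion_of_isIntegral (φ.endRing_mul_comm hK) l (RatFunc Fq)
    fun x hx => ?_
  -- As `D = K`, integral elements of `D` already lie in `B`.
  have hxK : x ∈ φ.frobField := φ.frobField_eq_top hK ▸ Algebra.mem_top
  have hxm : x ∈ φ.maxLattice := by
    refine ⟨⟨x, hxK⟩, ?_, rfl⟩
    obtain ⟨p, hp, hpx⟩ := hx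
    refine ⟨p, hp, Subtype.ext ?_⟩
    have := Polynomial.hom_eval₂ p (algebraMap Fq[X] φ.frobField) φ.frobField.val.toRingHom ⟨x, hxK⟩
    exact this.trans hpx
  obtain ⟨s, hs, e, he⟩ := h x hxm
  exact ⟨s, hs, e, he.symm⟩

end DrinfeldModule

end

theorem mainTheorem7 {Fq k : Type*} [Field Fq] [Fintype Fq] [Field k] [Finite k]
    [Algebra Fq k] [Algebra Fq[X] k] [IsScalarTower Fq Fq[X] k] {r : ℕ}
    (φ : DrinfeldModule Fq k r)
    (hK : Module.finrank (RatFunc Fq) φ.frobField = r)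
    (l : Ideal Fq[X]) (hl : l.IsPrime) (hl0 : l ≠ ⊥) :
    ((Algebra.adjoin (AdicCompletion l Fq[X]) {(1 ⊗ₜ φ.frob : φ.EndCompletion l)} = ⊤ ∨
        r = 2 ∨
        φ.endLattice.baseChange (AdicCompletion l Fq[X]) =
          φ.maxLattice.baseChange (AdicCompletion l Fq[X])) →
      IsGorensteinAlgebra (l.map (algebraMap Fq[X] (AdicCompletion l Fq[X])))
        (φ.EndCompletion l)) ∧
    ((¬ l ∣ moduleIndex Fq[X] (φ.EndRing ⧸ Subalgebra.toSubmodule φ.frobOrder) ∨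
        ¬ l ∣ moduleIndex Fq[X]
          (φ.maxLattice ⧸ φ.endLattice.submoduleOf φ.maxLattice)) →
      IsGorensteinAlgebra (l.map (algebraMap Fq[X] (AdicCompletion l Fq[X])))
        (φ.EndCompletion l)) := by
  have : l.IsMaximal := hl.isMaximal hl0
  have hc := φ.endRing_mul_comm hK
  constructor
  · rintro (h | rfl | h)
    · exact isGorensteinAlgebra_completion_of_adjoin_eq_top' hc l _ h
    · exact isGorensteinAlgebra_completion_of_finrank_le_two hc l (φ.finrank_endRing_le hK)
    · refine φ.isGorensteinAlgebra_endCompletion_of_maxLattice hK l fun x hx => ?_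
      -- Equality of the lattices after completion descends to the localization at `l`: each element
      -- of `B` has a multiple by some `s ∉ l` in `ℰ`.
      apply exists_notMem_smul_mem_of_mem_baseChange
      rw [h]
      exact Submodule.tmul_mem_baseChange_of_mem 1 hx
  · rintro (h | h)
    · obtain ⟨c, hcl, h⟩ := exists_notMem_smul_eq_zero_of_not_dvd_moduleIndex h
      refine isGorensteinAlgebra_completion_of_adjoin_eq_top' hc l (1 ⊗ₜ φ.frob)
        (adjoin_one_tmul_eq_top_of_smul_mem l hcl fun e => ?_)
      exact (Submodule.Quotient.mk_eq_zero _).1 (h (Submodule.Quotient.mk e))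
    · obtain ⟨c, hcl, h⟩ := exists_notMem_smul_eq_zero_of_not_dvd_moduleIndex h
      refine φ.isGorensteinAlgebra_endCompletion_of_maxLattice hK l fun x hx => ⟨c, hcl, ?_⟩
      exact (Submodule.Quotient.mk_eq_zero (φ.endLattice.submoduleOf φ.maxLattice)).1
        (h (Submodule.Quotient.mk ⟨x, hx⟩))
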